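/- Let $\{X_t\}_{t\in\mathbb Z}$ be an $\mathbb R^d$-valued time series, let $F_t$ be the distribution function of $X_t$, and let $\theta=\theta(F)\in\mathbb R^p$ be a functional of distribution functions. Let $T>0$, and let $W$ be a standard $p$-dimensional Brownian motion; put $B(s,t)=tW(s)-sW(t)$. For $i\le j$ let $\hat\theta_i^j=\theta(\hat F_i^j)$, where $\hat F_i^j(z)=\frac1{j-i+1}\sum_{t=i}^j I\{X_t\le z\}$ (componentwise inequality). Assume the null hypothesis $\theta(F_1)=\theta(F_2)=\cdots$ and the following. (A1) $\{X_t\}$ is strictly stationary with marginal distribution function $F$. With $\delta_x(z)=I\{x\le z\}$, the influence function $\mathcal{IF}(x)=\lim_{\varepsilon\searrow0}\varepsilon^{-1}\big(\theta((1-\varepsilon)F+\varepsilon\delta_x)-\theta(F)\big)$ exists for all $x$. The variables $\mathcal{IF}(X_t)$ are square integrable with $\mathbb E[\mathcal{IF}(X_1)]=0$. The series $\Sigma_F=\sum_{t\in\mathbb Z}\mathrm{Cov}(\mathcal{IF}(X_0),\mathcal{IF}(X_t))$ converges (in the sense of symmetric partial sums). As $m\to\infty$, $$\frac1{\sqrt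 m}\sum_{t=1}^{\lfloor ms\rfloor}\mathcal{IF}(X_t)\ \Longrightarrow\ \Sigma_F^{1/2}W(s)\quad\text{weakly in }\ell^\infty([0,T+1],\mathbb R^p).$$ (A2) The remainders $R_{i,j}=\hat\theta_i^j-\theta(F)-\frac1{j-i+1}\sum_{t=i}^j\mathcal{IF}(X_t)$ satisfy $\sup_{1\le i\le j\le n}(j-i+1)|R_{i,j}|=o_{\mathbb P}(n^{1/2})$ as $n\to\infty$. Assume further that $\Sigma_F$ is non-singular. Let $\hat\Sigma_m$ be (almost surely) non-singular random $p\times p$ matrices with $\hat\Sigma_m\to\Sigma_F$ in probability, and let $w:[0,T]\to(0,\infty)$ be increasing (not necessarily strictly). For $k\ge1$ define $$\hat D_m(k)=m^{-3}\max_{0\le j\le k-1}(m+j)^2(k-j)^2\big(\hat\theta_1^{m+j}-\hat\theta_{m+j+1}^{m+k}\big)^\top\hat\Sigma_m^{-1}\big(\hat\theta_1^{m+j}-\hat\theta_{m+j+1}^{m+k}\big).$$ Then, as $m\to\infty$, $$\max_{1\le k\le Tm}\frac{\hat D_m(k)}{w(k/m)}\ \overset{\mathcal D}{\Longrightarrow}\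 L:=\sup_{t\in[1,T+1]}\ \sup_{s\in[1,t]}\frac{B(s,t)^\top B(s,t)}{w(t-1)}.$$ Consequently, the monitoring scheme which rejects at the stopping time $\tau_m=\inf\{1\le k\le Tm:\hat D_m(k)>w(k/m)\}$ (with $\inf\emptyset=\infty$) has asymptotic level $\alpha$: if $w$ satisfies $\mathbb P(L>1)=\alpha$, then $$\lim_{m\to\infty}\mathbb P(\tau_m<\infty)=\lim_{m\to\infty}\mathbb P\Big(\max_{1\le k\le Tm}\frac{\hat D_m(k)}{w(k/m)}>1\Big)=\alpha.$$ -/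

import Mathlib

open MeasureTheory ProbabilityTheory Filter Topology
open scoped ENNReal NNReal Matrix MatrixOrder

namespace SeqMonitoring

noncomputable section

/-! ### Distribution functions, functionals and influence functions -/

/-- The distribution function `z ↦ μ {x | x ≤ z}` (componentwise order) of a measure on `ℝ^d`. -/
def distributionFunction {d : ℕ} (μ : Measure (Fin d → ℝ)) : (Fin d → ℝ) → ℝ :=
  fun z => μ.real {x | x ≤ z}

open Classical in
/-- The distribution function `z ↦ I{x ≤ z}` of the Dirac measure at `x`. -/
def diracDF {d : ℕ} (x : Fin d → ℝ) : (Fin d → ℝ) → ℝ :=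
  fun z => if x ≤ z then 1 else 0

/-- `IF` is the influence function of the functional `θ` at the distribution function `F`: the
limit of `(θ((1-ε)F + ε δ_x) - θ(F)) / ε` as `ε ↘ 0` exists and equals `IF x`, for every `x`.
(A functional which is only defined for some distribution functions is extended arbitrarily.) -/
def HasInfluenceFunction {d p : ℕ} (θ : ((Fin d → ℝ) → ℝ) → EuclideanSpace ℝ (Fin p))
    (F : (Fin d → ℝ) → ℝ) (IF : (Fin d → ℝ) → EuclideanSpace ℝ (Fin p)) : Prop :=
  ∀ x, Tendsto (fun ε : ℝ => ε⁻¹ • (θ ((1 - ε) • F + ε • diracDF x) - θ F)) (𝓝[>] 0) (𝓝 (IF x))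

variable {Ω Ω' : Type*} [MeasurableSpace Ω] [MeasurableSpace Ω']

/-- The distribution function `F_t` of `X_t`. -/
def marginalDF {d : ℕ} (P : Measure Ω) (X : ℤ → Ω → (Fin d → ℝ)) (t : ℤ) : (Fin d → ℝ) → ℝ :=
  distributionFunction (P.map (X t))

/-- The null hypothesis `θ(F_1) = θ(F_2) = …`. -/
def NullHypothesis {d p : ℕ} (θ : ((Fin d → ℝ) → ℝ) → EuclideanSpace ℝ (Fin p))
    (P : Measure Ω) (X : ℤ → Ω → (Fin d → ℝ)) : Prop :=
  ∀ t : ℤ, 1 ≤ t → θ (marginalDF P X t) = θ (marginalDF P X 1)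

/-- Strict stationarity: the law of the whole series is invariant under time shifts. -/
def StrictlyStationary {d : ℕ} (P : Measure Ω) (X : ℤ → Ω → (Fin d → ℝ)) : Prop :=
  ∀ h : ℤ, P.map (fun ω (t : ℤ) => X (t + h) ω) = P.map (fun ω (t : ℤ) => X t ω)

/-! ### Estimators, detector and stopping rule -/

/-- The empirical distribution function of `X_i, …, X_j`. -/
def empiricalDF {d : ℕ} (X : ℤ → Ω → (Fin d → ℝ)) (i j : ℕ) (ω : Ω) : (Fin d → ℝ) → ℝ :=
  fun z => ((j : ℝ) - i + 1)⁻¹ * ∑ t ∈ Finset.Icc i j, diracDF (X t ω) z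

/-- The estimator `θ̂_i^j = θ(F̂_i^j)`, with the convention `θ̂_i^j = 0` for `i > j`. -/
def thetaHat {d p : ℕ} (θ : ((Fin d → ℝ) → ℝ) → EuclideanSpace ℝ (Fin p))
    (X : ℤ → Ω → (Fin d → ℝ)) (i j : ℕ) (ω : Ω) : EuclideanSpace ℝ (Fin p) :=
  if i ≤ j then θ (empiricalDF X i j ω) else 0

/-- The detector
`D̂_m(k) = m⁻³ max_{0≤j≤k-1} (m+j)² (k-j)² (θ̂_1^{m+j} - θ̂_{m+j+1}^{m+k})ᵀ A⁻¹ (…)`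
with `A = Σ̂_m(ω)`; the maximum is over a nonempty finite set when `k ≥ 1`. -/
def detector {d p : ℕ} (θ : ((Fin d → ℝ) → ℝ) → EuclideanSpace ℝ (Fin p))
    (X : ℤ → Ω → (Fin d → ℝ)) (SigmaHat : ℕ → Ω → Matrix (Fin p) (Fin p) ℝ)
    (m k : ℕ) (ω : Ω) : ℝ :=
  ((m : ℝ) ^ 3)⁻¹ * ⨆ j : Fin k,
    ((m : ℝ) + (j : ℕ)) ^ 2 * ((k : ℝ) - (j : ℕ)) ^ 2 *
      (let v := thetaHat θ X 1 (m + j) ω - thetaHat θ X (m + j + 1) (m + k) ω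
       v.ofLp ⬝ᵥ ((SigmaHat m ω)⁻¹ *ᵥ v.ofLp))

/-- The monitoring statistic `max_{1 ≤ k ≤ Tm} D̂_m(k) / w(k/m)`
(the index set is `{1, …, ⌊Tm⌋}`, which is `{1, …, Tm}` when `Tm` is an integer). -/
def monitoringStat {d p : ℕ} (θ : ((Fin d → ℝ) → ℝ) → EuclideanSpace ℝ (Fin p))
    (X : ℤ → Ω → (Fin d → ℝ)) (SigmaHat : ℕ → Ω → Matrix (Fin p) (Fin p) ℝ)
    (T : ℝ) (w : ℝ → ℝ) (m : ℕ) (ω : Ω) : ℝ :=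
  ⨆ k : Finset.Icc 1 ⌊T * m⌋₊, detector θ X SigmaHat m k ω / w (((k : ℕ) : ℝ) / m)

/-- The stopping rule `τ_m = inf {1 ≤ k ≤ Tm | D̂_m(k) > w(k/m)}`, with `inf ∅ = ∞`. -/
def stoppingRule {d p : ℕ} (θ : ((Fin d → ℝ) → ℝ) → EuclideanSpace ℝ (Fin p))
    (X : ℤ → Ω → (Fin d → ℝ)) (SigmaHat : ℕ → Ω → Matrix (Fin p) (Fin p) ℝ)
    (T : ℝ) (w : ℝ → ℝ) (m : ℕ) (ω : Ω) : ℕ∞ :=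
  sInf ((fun k : ℕ => (k : ℕ∞)) ''
    {k | 1 ≤ k ∧ k ≤ ⌊T * m⌋₊ ∧ w ((k : ℝ) / m) < detector θ X SigmaHat m k ω})

/-! ### Brownian motion and the limit variable -/

/-- Standard `p`-dimensional Brownian motion: independent components, each of which is a standard
real Brownian motion (with almost surely continuous paths). -/
structure IsStandardBrownianMotion {p : ℕ} (W : ℝ≥0 → Ω' → EuclideanSpace ℝ (Fin p))
    (P' : Measure Ω') : Prop where
  isBrownianReal : ∀ a : Fin p, IsBrownianReal (fun t ω => W t ω a) P'
  indep : iIndepFun (fun (a : Fin p) ω (t : ℝ≥0) => W t ω a) P'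

/-- The process `B(s,t) = t W(s) - s W(t)`, for `s, t ≥ 0`. -/
def bridge {p : ℕ} (W : ℝ≥0 → Ω' → EuclideanSpace ℝ (Fin p)) (s t : ℝ) (ω : Ω') :
    EuclideanSpace ℝ (Fin p) :=
  t • W s.toNNReal ω - s • W t.toNNReal ω

/-- The limit variable `sup_{t ∈ [1,T+1]} sup_{s ∈ [1,t]} B(s,t)ᵀ B(s,t) / w(t-1)`. -/
def limitStat {p : ℕ} (W : ℝ≥0 → Ω' → EuclideanSpace ℝ (Fin p)) (T : ℝ) (w : ℝ → ℝ)
    (ω : Ω') : ℝ :=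
  ⨆ t : Set.Icc (1 : ℝ) (T + 1), ⨆ s : Set.Icc (1 : ℝ) (t : ℝ),
    ((bridge W s t ω).ofLp ⬝ᵥ (bridge W s t ω).ofLp) / w ((t : ℝ) - 1)

/-! ### Weak convergence in `ℓ^∞([0,T+1], ℝ^p)` -/

/-- The space `ℓ^∞([0,T+1], ℝ^p)` of bounded functions with the supremum norm. -/
abbrev LInfty (T : ℝ) (p : ℕ) : Type :=
  lp (fun _ : Set.Icc (0 : ℝ) (T + 1) => EuclideanSpace ℝ (Fin p)) ∞

/-- `ℓ^∞([0,T+1], ℝ^p)` carries its Borel σ-algebra. -/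
instance instMeasurableSpaceLInfty (T : ℝ) (p : ℕ) : MeasurableSpace (LInfty T p) :=
  borel _

instance instBorelSpaceLInfty (T : ℝ) (p : ℕ) : BorelSpace (LInfty T p) :=
  ⟨rfl⟩

open Classical in
/-- A bounded function on `[0,T+1]` as an element of `ℓ^∞([0,T+1], ℝ^p)`
(and `0` if the function is unbounded). -/
def toLInfty {T : ℝ} {p : ℕ} (f : Set.Icc (0 : ℝ) (T + 1) → EuclideanSpace ℝ (Fin p)) :
    LInfty T p :=
  if h : Memℓp f ∞ then ⟨f, h⟩ else 0

/-- The partial sum process `s ↦ m^{-1/2} ∑_{t=1}^{⌊ms⌋} Y_t` on `[0,T+1]`. -/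
def partialSumProcess {p : ℕ} (T : ℝ) (Y : ℤ → Ω → EuclideanSpace ℝ (Fin p)) (m : ℕ) (ω : Ω) :
    Set.Icc (0 : ℝ) (T + 1) → EuclideanSpace ℝ (Fin p) :=
  fun s => (√(m : ℝ))⁻¹ • ∑ t ∈ Finset.Icc 1 ⌊(m : ℝ) * (s : ℝ)⌋₊, Y t ω

/-- The process `s ↦ S^{1/2} W(s)` on `[0,T+1]`, with the positive semidefinite square root. -/
def scaledBrownian {p : ℕ} (T : ℝ) (S : Matrix (Fin p) (Fin p) ℝ)
    (W : ℝ≥0 → Ω' → EuclideanSpace ℝ (Fin p)) (ω : Ω') :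
    Set.Icc (0 : ℝ) (T + 1) → EuclideanSpace ℝ (Fin p) :=
  fun s => WithLp.toLp 2 (CFC.sqrt S *ᵥ (W (s : ℝ).toNNReal ω).ofLp)

/-- The partial sum process has bounded paths. -/
theorem memlp_partialSumProcess {p : ℕ} (T : ℝ) (Y : ℤ → Ω → EuclideanSpace ℝ (Fin p))
    (m : ℕ) (ω : Ω) : Memℓp (partialSumProcess T Y m ω) ∞ := by
  apply memℓp_infty
  refine ⟨‖(√(m : ℝ))⁻¹‖ * ∑ t ∈ Finset.Icc 1 ⌊(m : ℝ) * (T + 1)⌋₊, ‖Y t ω‖, ?_⟩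
  rintro _ ⟨s, rfl⟩
  simp only [partialSumProcess, norm_smul]
  refine mul_le_mul_of_nonneg_left ?_ (norm_nonneg _)
  refine (norm_sum_le _ _).trans (Finset.sum_le_sum_of_subset_of_nonneg ?_ ?_)
  · refine Finset.Icc_subset_Icc le_rfl (Nat.floor_mono ?_)
    exact mul_le_mul_of_nonneg_left s.2.2 (Nat.cast_nonneg m)
  · intros
    exact norm_nonneg _

/-- A continuous path of `W` gives a bounded path of `S^{1/2} W` on `[0,T+1]`. -/
theorem memlp_scaledBrownian {p : ℕ} (T : ℝ) (S : Matrix (Fin p) (Fin p) ℝ)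
    (W : ℝ≥0 → Ω' → EuclideanSpace ℝ (Fin p)) (ω : Ω') (h : Continuous fun t => W t ω) :
    Memℓp (scaledBrownian T S W ω) ∞ := by
  apply memℓp_infty
  have hc : Continuous fun s => ‖scaledBrownian T S W ω s‖ := by
    unfold scaledBrownian
    have h1 : Continuous fun s : Set.Icc (0 : ℝ) (T + 1) => W (s : ℝ).toNNReal ω :=
      h.comp (continuous_real_toNNReal.comp continuous_subtype_val)
    fun_prop
  exact (isCompact_range hc).bddAbove

/-! ### Assumptions on the time series -/

/-- `S = ∑_{t ∈ ℤ} Cov(Y_0, Y_t)`: the variables are square integrable and the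
(symmetric partial sums of the) series of covariance matrices converges to `S`. -/
structure IsLongRunVariance {p : ℕ} (P : Measure Ω) (Y : ℤ → Ω → EuclideanSpace ℝ (Fin p))
    (S : Matrix (Fin p) (Fin p) ℝ) : Prop where
  memLp : ∀ t, MemLp (Y t) 2 P
  tendsto : ∀ a b : Fin p, Tendsto (fun n : ℕ => ∑ t ∈ Finset.Icc (-(n : ℤ)) n,
    cov[fun ω => Y 0 ω a, fun ω => Y t ω b; P]) atTop (𝓝 (S a b))

/-- The first assumption: strict stationarity, existence of the influence function `IF` at the
marginal distribution function, centering, existence of the long-run variance `S = Σ_F`, and the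
weak convergence of the partial sums of `IF(X_t)` to `Σ_F^{1/2} W` in `ℓ^∞([0,T+1], ℝ^p)`. -/
structure InvarianceAssumption {d p : ℕ} (P : Measure Ω) [IsProbabilityMeasure P]
    (X : ℤ → Ω → (Fin d → ℝ)) (θ : ((Fin d → ℝ) → ℝ) → EuclideanSpace ℝ (Fin p))
    (IF : (Fin d → ℝ) → EuclideanSpace ℝ (Fin p)) (S : Matrix (Fin p) (Fin p) ℝ) (T : ℝ)
    (P' : Measure Ω') [IsProbabilityMeasure P']
    (W : ℝ≥0 → Ω' → EuclideanSpace ℝ (Fin p)) : Prop where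
  stationary : StrictlyStationary P X
  influence : HasInfluenceFunction θ (marginalDF P X 1) IF
  centered : ∫ ω, IF (X 1 ω) ∂P = 0
  longRun : IsLongRunVariance P (fun t ω => IF (X t ω)) S
  weakConvergence : TendstoInDistribution
    (fun (m : ℕ) ω => toLInfty (partialSumProcess T (fun t ω => IF (X t ω)) m ω)) atTop
    (fun ω' => toLInfty (scaledBrownian T S W ω')) (fun _ => P) P'

/-- The remainder `R_{i,j} = θ̂_i^j - θ(F) - (j-i+1)⁻¹ ∑_{t=i}^j IF(X_t)`. -/
def remainder {d p : ℕ} (P : Measure Ω) (X : ℤ → Ω → (Fin d → ℝ))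
    (θ : ((Fin d → ℝ) → ℝ) → EuclideanSpace ℝ (Fin p))
    (IF : (Fin d → ℝ) → EuclideanSpace ℝ (Fin p)) (i j : ℕ) (ω : Ω) :
    EuclideanSpace ℝ (Fin p) :=
  thetaHat θ X i j ω - θ (marginalDF P X 1)
    - ((j : ℝ) - i + 1)⁻¹ • ∑ t ∈ Finset.Icc i j, IF (X t ω)

/-- The second assumption: `sup_{1 ≤ i ≤ j ≤ n} (j-i+1) |R_{i,j}| = o_P(n^{1/2})`. -/
def RemainderAssumption {d p : ℕ} (P : Measure Ω) (X : ℤ → Ω → (Fin d → ℝ))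
    (θ : ((Fin d → ℝ) → ℝ) → EuclideanSpace ℝ (Fin p))
    (IF : (Fin d → ℝ) → EuclideanSpace ℝ (Fin p)) : Prop :=
  TendstoInMeasure P
    (fun (n : ℕ) ω => (⨆ ij : {ij : ℕ × ℕ // 1 ≤ ij.1 ∧ ij.1 ≤ ij.2 ∧ ij.2 ≤ n},
      ((ij.1.2 : ℝ) - ij.1.1 + 1) * ‖remainder P X θ IF ij.1.1 ij.1.2 ω‖) / √(n : ℝ))
    atTop (fun _ => (0 : ℝ))

end

end SeqMonitoring

open SeqMonitoring

/-! Write $h_m(s)=m^{-1/2}\sum_{t\le ms}\mathcal{IF}(X_t)$. At the grid times $s=(m+j)/m$ and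
$t=(m+k)/m$ the scaled difference $m^{-3/2}(m+j)(k-j)(\hat\theta_1^{m+j}-\hat\theta_{m+j+1}^{m+k})$
equals $t\,h_m(s)-s\,h_m(t)$ exactly, up to remainders that (A2) makes uniformly negligible
(`scaledDiff_sub_pathForm`, `norm_scaledDiff_sub_pathForm_le`). Replacing $\hat\Sigma_m^{-1}$ by
$\Sigma_F^{-1}$ and the grid by the continuum costs a further $o_P(1)$
(`abs_gridMax_sub_supFunctional_le`). So the statistic is asymptotically a functional of $h_m$, the
functional is continuous on $\ell^\infty$ (`continuous_supFunctionalLInfty`), and the continuous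
mapping theorem with Slutsky's lemma gives the limit. At $\Sigma_F^{1/2}W$ the square root cancels
$\Sigma_F^{-1}$, which needs $\Sigma_F\ge0$; this follows from stationarity
(`posSemidef_of_isLongRunVariance`).

The level statement also needs $P(L=1)=0$. Fix a coordinate $a$ and condition on everything except
$\xi=W_a(1)$. Each $|B(s,t)|^2/w(t-1)$ is then a quadratic in $\xi$ with leading coefficient
$(t-s)^2/w(t-1)$. While $t-s$ stays away from $0$, the supremum of these quadratics is strictly
convex in $\xi$ and takes the value $1$ at most twice, whereas $\xi$ is Gaussian and independent of
the coefficients. Near the diagonal $B$ is small, so those pairs do not affect the event $L=1$.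

Continuity of $w$ is never used: monotonicity gives $w\ge w(0)>0$ and lets $t$ be rounded down. -/

namespace SeqMonitoring

noncomputable section

/-! ### Quadratic forms -/

/-- The quadratic form `v ↦ vᵀ B v`. -/
def quadForm {p : ℕ} (B : Matrix (Fin p) (Fin p) ℝ) (v : EuclideanSpace ℝ (Fin p)) : ℝ :=
  v.ofLp ⬝ᵥ (B *ᵥ v.ofLp)

/-- The sum of the absolute values of the entries of a matrix. -/
def entrySum {p : ℕ} (B : Matrix (Fin p) (Fin p) ℝ) : ℝ := ∑ a, ∑ b, |B a b|

theorem entrySum_nonneg {p : ℕ} (B : Matrix (Fin p) (Fin p) ℝ) : 0 ≤ entrySum B :=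
  Finset.sum_nonneg fun _ _ => Finset.sum_nonneg fun _ _ => abs_nonneg _

theorem abs_dotProduct_mulVec_le {p : ℕ} (B : Matrix (Fin p) (Fin p) ℝ)
    (u v : EuclideanSpace ℝ (Fin p)) :
    |u.ofLp ⬝ᵥ (B *ᵥ v.ofLp)| ≤ entrySum B * ‖u‖ * ‖v‖ := by
  have hc : ∀ (x : EuclideanSpace ℝ (Fin p)) a, |x.ofLp a| ≤ ‖x‖ := fun x a => by
    simpa using PiLp.norm_apply_le x a
  simp only [dotProduct, Matrix.mulVec, entrySum, Finset.mul_sum, Finset.sum_mul]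
  refine (Finset.abs_sum_le_sum_abs _ _).trans (Finset.sum_le_sum fun a _ => ?_)
  refine (Finset.abs_sum_le_sum_abs _ _).trans (Finset.sum_le_sum fun b _ => ?_)
  rw [abs_mul, abs_mul]
  calc |u.ofLp a| * (|B a b| * |v.ofLp b|) = |B a b| * |u.ofLp a| * |v.ofLp b| := by ring
    _ ≤ |B a b| * ‖u‖ * ‖v‖ := by gcongr <;> exact hc _ _

theorem abs_quadForm_le {p : ℕ} (B : Matrix (Fin p) (Fin p) ℝ) (v : EuclideanSpace ℝ (Fin p))
    {V : ℝ} (hv : ‖v‖ ≤ V) : |quadForm B v| ≤ entrySum B * V ^ 2 := by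
  refine (abs_dotProduct_mulVec_le B v v).trans ?_
  rw [mul_assoc, ← sq]
  have := entrySum_nonneg B
  gcongr

theorem quadForm_smul {p : ℕ} (B : Matrix (Fin p) (Fin p) ℝ) (c : ℝ)
    (v : EuclideanSpace ℝ (Fin p)) : quadForm B (c • v) = c ^ 2 * quadForm B v := by
  simp only [quadForm, WithLp.ofLp_smul, Matrix.mulVec_smul, dotProduct_smul, smul_dotProduct,
    smul_eq_mul]
  ring

theorem quadForm_zero {p : ℕ} (B : Matrix (Fin p) (Fin p) ℝ) : quadForm B 0 = 0 := by
  simp [quadForm]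

/-- Separates the error in the matrix from the error in the vector: `A - B` is evaluated at `u`, and
`B` is expanded around `v`. Both cross terms are kept because `B` need not be symmetric. -/
theorem abs_quadForm_sub_quadForm_le {p : ℕ} (A B : Matrix (Fin p) (Fin p) ℝ)
    (u v : EuclideanSpace ℝ (Fin p)) {V ρ : ℝ} (hv : ‖v‖ ≤ V) (huv : ‖u - v‖ ≤ ρ) :
    |quadForm A u - quadForm B v| ≤
      entrySum (A - B) * (V + ρ) ^ 2 + entrySum B * (2 * V * ρ + ρ ^ 2) := by
  have hu : ‖u‖ ≤ V + ρ := by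
    calc ‖u‖ = ‖v + (u - v)‖ := by congr 1; abel
      _ ≤ ‖v‖ + ‖u - v‖ := norm_add_le _ _
      _ ≤ _ := add_le_add hv huv
  have hB := entrySum_nonneg B
  have hV : 0 ≤ V := (norm_nonneg _).trans hv
  have hρ : 0 ≤ ρ := (norm_nonneg _).trans huv
  have h1 := abs_quadForm_le (A - B) u hu
  have h2 := abs_dotProduct_mulVec_le B (u - v) (u - v)
  have h3 := abs_dotProduct_mulVec_le B (u - v) v
  have h4 := abs_dotProduct_mulVec_le B v (u - v)
  have key : quadForm A u - quadForm B v = quadForm (A - B) u +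
      ((u - v).ofLp ⬝ᵥ (B *ᵥ (u - v).ofLp) + (u - v).ofLp ⬝ᵥ (B *ᵥ v.ofLp) +
        v.ofLp ⬝ᵥ (B *ᵥ (u - v).ofLp)) := by
    simp only [quadForm, WithLp.ofLp_sub, Matrix.sub_mulVec, Matrix.mulVec_sub, dotProduct_sub,
      sub_dotProduct]
    ring
  have e2 : entrySum B * ‖u - v‖ * ‖u - v‖ ≤ entrySum B * ρ * ρ := by gcongr
  have e3 : entrySum B * ‖u - v‖ * ‖v‖ ≤ entrySum B * ρ * V := by gcongr
  have e4 : entrySum B * ‖v‖ * ‖u - v‖ ≤ entrySum B * V * ρ := by gcongr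
  rw [key]
  calc _ ≤ |quadForm (A - B) u| + (|(u - v).ofLp ⬝ᵥ (B *ᵥ (u - v).ofLp)| +
        |(u - v).ofLp ⬝ᵥ (B *ᵥ v.ofLp)| + |v.ofLp ⬝ᵥ (B *ᵥ (u - v).ofLp)|) := by
        refine (abs_add_le _ _).trans (add_le_add le_rfl ?_)
        exact (abs_add_le _ _).trans (add_le_add (abs_add_le _ _) le_rfl)
    _ ≤ _ := by linarith

/-! ### The limit functional -/

/-- The vector `t h(s) - s h(t)` attached to a path `h`. -/
def pathForm {p : ℕ} (h : ℝ → EuclideanSpace ℝ (Fin p)) (s t : ℝ) : EuclideanSpace ℝ (Fin p) :=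
  t • h s - s • h t

/-- The functional `h ↦ sup_{t ∈ [1,T+1]} sup_{s ∈ [1,t]} vᵀ B v / w(t-1)` with
`v = t h(s) - s h(t)`. -/
def supFunctional {p : ℕ} (B : Matrix (Fin p) (Fin p) ℝ) (w : ℝ → ℝ) (T : ℝ)
    (h : ℝ → EuclideanSpace ℝ (Fin p)) : ℝ :=
  ⨆ t : Set.Icc (1 : ℝ) (T + 1), ⨆ s : Set.Icc (1 : ℝ) (t : ℝ),
    quadForm B (pathForm h s t) / w ((t : ℝ) - 1)

theorem norm_pathForm_le {p : ℕ} {h : ℝ → EuclideanSpace ℝ (Fin p)} {T N s t : ℝ}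
    (hs : 1 ≤ s) (hst : s ≤ t) (htT : t ≤ T + 1) (hN : ∀ s ∈ Set.Icc (1 : ℝ) (T + 1), ‖h s‖ ≤ N) :
    ‖pathForm h s t‖ ≤ 2 * (T + 1) * N := by
  have h1 := hN s ⟨hs, hst.trans htT⟩
  have h2 := hN t ⟨hs.trans hst, htT⟩
  have hN0 : 0 ≤ N := (norm_nonneg _).trans h1
  refine (norm_sub_le _ _).trans ?_
  rw [norm_smul, norm_smul, Real.norm_of_nonneg (by linarith), Real.norm_of_nonneg (by linarith)]
  have e1 : t * ‖h s‖ ≤ (T + 1) * N := by gcongr; linarith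
  have e2 : s * ‖h t‖ ≤ (T + 1) * N := by gcongr <;> linarith
  linarith

section

variable {p : ℕ} {B : Matrix (Fin p) (Fin p) ℝ} {w : ℝ → ℝ} {T : ℝ}
  {h : ℝ → EuclideanSpace ℝ (Fin p)}

theorem abs_quadForm_pathForm_div_le (hw_mono : MonotoneOn w (Set.Icc 0 T))
    (hw_pos : ∀ x ∈ Set.Icc 0 T, 0 < w x) {N s t : ℝ} (hs : 1 ≤ s) (hst : s ≤ t)
    (htT : t ≤ T + 1) (hN : ∀ s ∈ Set.Icc (1 : ℝ) (T + 1), ‖h s‖ ≤ N) :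
    |quadForm B (pathForm h s t) / w (t - 1)| ≤ entrySum B * (2 * (T + 1) * N) ^ 2 / w 0 := by
  have h0 : (0 : ℝ) ∈ Set.Icc 0 T := ⟨le_rfl, by linarith⟩
  have ht : t - 1 ∈ Set.Icc 0 T := ⟨by linarith, by linarith⟩
  have hB := entrySum_nonneg B
  rw [abs_div, abs_of_pos (hw_pos _ ht)]
  refine div_le_div₀ (by positivity) (abs_quadForm_le B _ (norm_pathForm_le hs hst htT hN))
    (hw_pos _ h0) (hw_mono h0 ht ht.1)

/-- The bound on the path is essential: a real supremum over an unbounded family has the default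
value `0`. -/
theorem le_supFunctional (hw_mono : MonotoneOn w (Set.Icc 0 T))
    (hw_pos : ∀ x ∈ Set.Icc 0 T, 0 < w x) {N s t : ℝ} (hs : 1 ≤ s) (hst : s ≤ t)
    (htT : t ≤ T + 1) (hN : ∀ s ∈ Set.Icc (1 : ℝ) (T + 1), ‖h s‖ ≤ N) :
    quadForm B (pathForm h s t) / w (t - 1) ≤ supFunctional B w T h := by
  have hb : ∀ (t : Set.Icc (1 : ℝ) (T + 1)) (s : Set.Icc (1 : ℝ) (t : ℝ)),
      quadForm B (pathForm h s t) / w ((t : ℝ) - 1) ≤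
        entrySum B * (2 * (T + 1) * N) ^ 2 / w 0 := fun t s =>
    (le_abs_self _).trans (abs_quadForm_pathForm_div_le hw_mono hw_pos s.2.1 s.2.2 t.2.2 hN)
  have h2 : BddAbove (Set.range fun t : Set.Icc (1 : ℝ) (T + 1) =>
      ⨆ s : Set.Icc (1 : ℝ) (t : ℝ), quadForm B (pathForm h s t) / w ((t : ℝ) - 1)) := by
    refine ⟨entrySum B * (2 * (T + 1) * N) ^ 2 / w 0, ?_⟩
    rintro _ ⟨t, rfl⟩
    have : Nonempty (Set.Icc (1 : ℝ) (t : ℝ)) := ⟨⟨1, le_rfl, t.2.1⟩⟩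
    exact ciSup_le (hb t)
  let t' : Set.Icc (1 : ℝ) (T + 1) := ⟨t, hs.trans hst, htT⟩
  let s' : Set.Icc (1 : ℝ) (t' : ℝ) := ⟨s, hs, hst⟩
  exact (le_ciSup (f := fun s : Set.Icc (1 : ℝ) (t' : ℝ) =>
    quadForm B (pathForm h s t') / w ((t' : ℝ) - 1))
    ⟨_, by rintro _ ⟨s, rfl⟩; exact hb t' s⟩ s').trans (le_ciSup h2 t')

theorem supFunctional_le (hT : 0 ≤ T) {c : ℝ} (hc : ∀ s t : ℝ, 1 ≤ s → s ≤ t → t ≤ T + 1 →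
    quadForm B (pathForm h s t) / w (t - 1) ≤ c) : supFunctional B w T h ≤ c := by
  have : Nonempty (Set.Icc (1 : ℝ) (T + 1)) := ⟨⟨1, le_rfl, by linarith⟩⟩
  refine ciSup_le fun t => ?_
  have : Nonempty (Set.Icc (1 : ℝ) (t : ℝ)) := ⟨⟨1, le_rfl, t.2.1⟩⟩
  exact ciSup_le fun s => hc s t s.2.1 s.2.2 t.2.2

theorem supFunctional_congr {B' : Matrix (Fin p) (Fin p) ℝ} {g : ℝ → EuclideanSpace ℝ (Fin p)}
    (hgh : ∀ s t : ℝ, 1 ≤ s → s ≤ t → t ≤ T + 1 →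
      quadForm B (pathForm h s t) = quadForm B' (pathForm g s t)) :
    supFunctional B w T h = supFunctional B' w T g := by
  refine iSup_congr fun t => iSup_congr fun s => ?_
  rw [hgh s t s.2.1 s.2.2 t.2.2]

theorem pathForm_self (t : ℝ) : pathForm h t t = 0 := sub_self _

theorem pathForm_sub (g : ℝ → EuclideanSpace ℝ (Fin p)) (s t : ℝ) :
    pathForm (h - g) s t = pathForm h s t - pathForm g s t := by
  simp only [pathForm, Pi.sub_apply, smul_sub]
  abel

/-- `pathForm` is linear in the path, so a perturbation of size `ρ` moves it by at most `2 * (T + 1)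
* ρ`. The resulting local Lipschitz bound involves `w` only through `w 0`. -/
theorem supFunctional_le_add (hT : 0 ≤ T) (hw_mono : MonotoneOn w (Set.Icc 0 T))
    (hw_pos : ∀ x ∈ Set.Icc 0 T, 0 < w x) {g : ℝ → EuclideanSpace ℝ (Fin p)} {N ρ : ℝ}
    (hg : ∀ s ∈ Set.Icc (1 : ℝ) (T + 1), ‖g s‖ ≤ N)
    (hhg : ∀ s ∈ Set.Icc (1 : ℝ) (T + 1), ‖h s - g s‖ ≤ ρ) :
    supFunctional B w T h ≤ supFunctional B w T g +
      entrySum B * (2 * (2 * (T + 1) * N) * (2 * (T + 1) * ρ) + (2 * (T + 1) * ρ) ^ 2) / w 0 := by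
  have h0 : (0 : ℝ) ∈ Set.Icc 0 T := ⟨le_rfl, by linarith⟩
  refine supFunctional_le hT fun s t hs hst htT => ?_
  have ht : t - 1 ∈ Set.Icc 0 T := ⟨by linarith, by linarith⟩
  have hV := norm_pathForm_le hs hst htT hg
  have hρ := norm_pathForm_le (h := h - g) hs hst htT hhg
  rw [pathForm_sub] at hρ
  have h1 := abs_quadForm_sub_quadForm_le B B _ _ hV hρ
  have h1' : quadForm B (pathForm h s t) - quadForm B (pathForm g s t) ≤ entrySum B *
      (2 * (2 * (T + 1) * N) * (2 * (T + 1) * ρ) + (2 * (T + 1) * ρ) ^ 2) := by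
    refine (le_abs_self _).trans (h1.trans_eq ?_)
    simp [entrySum]
  have h2 := le_supFunctional (B := B) hw_mono hw_pos hs hst htT hg
  have h3 : (quadForm B (pathForm h s t) - quadForm B (pathForm g s t)) / w (t - 1) ≤
      entrySum B * (2 * (2 * (T + 1) * N) * (2 * (T + 1) * ρ) + (2 * (T + 1) * ρ) ^ 2) / w 0 := by
    refine div_le_div₀ ?_ h1' (hw_pos _ h0) (hw_mono h0 ht ht.1)
    have := (norm_nonneg _).trans hV
    have := (norm_nonneg _).trans hρ
    have := entrySum_nonneg B
    positivity
  rw [sub_div] at h3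
  linarith

/-- The maximum over the grid `1 ≤ k ≤ Tm`, `0 ≤ j < k` differs little from the supremum over all
`1 ≤ s ≤ t ≤ T + 1` if the path is constant between grid points. -/
theorem abs_gridMax_sub_supFunctional_le {A : Matrix (Fin p) (Fin p) ℝ}
    (hT : 0 ≤ T) (hw_mono : MonotoneOn w (Set.Icc 0 T))
    (hw_pos : ∀ x ∈ Set.Icc 0 T, 0 < w x) (hB : ∀ v, 0 ≤ quadForm B v) {m : ℕ}
    (hTm : 1 ≤ T * m) {N ρ : ℝ} (hN : ∀ s ∈ Set.Icc (1 : ℝ) (T + 1), ‖h s‖ ≤ N)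
    (hstep : ∀ s, 0 ≤ s → h (⌊(m : ℝ) * s⌋₊ / m) = h s)
    {u : ℕ → ℕ → EuclideanSpace ℝ (Fin p)}
    (hu : ∀ j k : ℕ, j < k → k ≤ ⌊T * m⌋₊ →
      ‖u j k - pathForm h (((m : ℝ) + j) / m) (((m : ℝ) + k) / m)‖ ≤ ρ) :
    |(⨆ k : Finset.Icc 1 ⌊T * m⌋₊, (⨆ j : Fin (k : ℕ), quadForm A (u j k)) / w (((k : ℕ) : ℝ) / m))
        - supFunctional B w T h| ≤
      (entrySum (A - B) * (2 * (T + 1) * N + ρ) ^ 2 +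
        entrySum B * (2 * (2 * (T + 1) * N) * ρ + ρ ^ 2)) / w 0 +
      entrySum B * (2 * (2 * (T + 1) * N) * (2 * N / m) + (2 * N / m) ^ 2) / w 0 := by
  set V := 2 * (T + 1) * N with hVdef
  set E1 := entrySum (A - B) * (V + ρ) ^ 2 + entrySum B * (2 * V * ρ + ρ ^ 2) with hE1
  set E2 := entrySum B * (2 * V * (2 * N / m) + (2 * N / m) ^ 2) with hE2
  have h0 : (0 : ℝ) ∈ Set.Icc 0 T := ⟨le_rfl, hT⟩
  have hw0 := hw_pos 0 h0
  have hm : 0 < (m : ℝ) := by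
    rcases Nat.eq_zero_or_pos m with rfl | h'
    · norm_num at hTm
    · exact_mod_cast h'
  have hfl : 1 ≤ ⌊T * m⌋₊ := Nat.le_floor (by simpa using hTm)
  have hN0 : 0 ≤ N := (norm_nonneg _).trans (hN 1 ⟨le_rfl, by linarith⟩)
  have hV0 : 0 ≤ V := by positivity
  have hρ0 : 0 ≤ ρ := (norm_nonneg _).trans (hu 0 1 one_pos hfl)
  have hE10 : 0 ≤ E1 := by
    have := entrySum_nonneg (A - B)
    have := entrySum_nonneg B
    positivity
  have hE20 : 0 ≤ E2 := by
    have := entrySum_nonneg B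
    positivity
  have hgrid : ∀ j k : ℕ, j ≤ k → k ≤ ⌊T * m⌋₊ → 1 ≤ ((m : ℝ) + j) / m ∧
      ((m : ℝ) + j) / m ≤ ((m : ℝ) + k) / m ∧ ((m : ℝ) + k) / m ≤ T + 1 ∧
      ((m : ℝ) + k) / m - 1 = k / m := by
    intro j k hjk hk
    have hk' : (k : ℝ) ≤ T * m := (Nat.cast_le.2 hk).trans (Nat.floor_le (by linarith))
    have hjk' : (j : ℝ) ≤ k := by exact_mod_cast hjk
    refine ⟨?_, ?_, ?_, ?_⟩
    · rw [le_div_iff₀ hm]; linarith [(Nat.cast_nonneg j : (0 : ℝ) ≤ j)]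
    · gcongr
    · rw [div_le_iff₀ hm]; linarith
    · field_simp; ring
  have hkT : ∀ k : ℕ, k ≤ ⌊T * m⌋₊ → (k : ℝ) / m ∈ Set.Icc 0 T := by
    intro k hk
    obtain ⟨h1, h2, h3, h4⟩ := hgrid k k le_rfl hk
    rw [← h4]
    constructor <;> linarith
  have hterm : ∀ j k : ℕ, j < k → k ≤ ⌊T * m⌋₊ →
      |quadForm A (u j k) - quadForm B (pathForm h (((m : ℝ) + j) / m) (((m : ℝ) + k) / m))|
        ≤ E1 := by
    intro j k hjk hk
    obtain ⟨h1, h2, h3, h4⟩ := hgrid j k hjk.le hk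
    exact abs_quadForm_sub_quadForm_le A B _ _ (norm_pathForm_le h1 h2 h3 hN) (hu j k hjk hk)
  set stat := ⨆ k : Finset.Icc 1 ⌊T * m⌋₊,
    (⨆ j : Fin (k : ℕ), quadForm A (u j k)) / w (((k : ℕ) : ℝ) / m) with hstat
  have hle_stat : ∀ j k : ℕ, j < k → k ≤ ⌊T * m⌋₊ →
      quadForm A (u j k) / w ((k : ℝ) / m) ≤ stat := by
    intro j k hjk hk
    have hfin : BddAbove (Set.range fun k : Finset.Icc 1 ⌊T * m⌋₊ =>
        (⨆ j : Fin (k : ℕ), quadForm A (u j k)) / w (((k : ℕ) : ℝ) / m)) :=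
      (Set.finite_range _).bddAbove
    refine le_trans ?_ (le_ciSup hfin ⟨k, Finset.mem_Icc.2 ⟨by omega, hk⟩⟩)
    have := (hw_pos _ (hkT k hk)).le
    refine div_le_div_of_nonneg_right ?_ this
    exact le_ciSup (f := fun j : Fin k => quadForm A (u j k))
      (Set.finite_range _).bddAbove ⟨j, hjk⟩
  have hscale : ∀ (x E : ℝ) (y : ℝ), y ∈ Set.Icc 0 T → 0 ≤ E → x ≤ E → x / w y ≤ E / w 0 := by
    intro x E y hy hE hx
    exact div_le_div₀ hE hx hw0 (hw_mono h0 hy hy.1)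
  have hA_lower : ∀ j k : ℕ, j < k → k ≤ ⌊T * m⌋₊ →
      quadForm B (pathForm h (((m : ℝ) + j) / m) (((m : ℝ) + k) / m)) / w ((k : ℝ) / m) ≤
        stat + E1 / w 0 := by
    intro j k hjk hk
    have h1 := hle_stat j k hjk hk
    have h2 := hscale (quadForm B (pathForm h (((m : ℝ) + j) / m) (((m : ℝ) + k) / m)) -
      quadForm A (u j k)) E1 _ (hkT k hk) hE10
      (by rw [← neg_sub]; exact (neg_le_abs _).trans (hterm j k hjk hk))
    rw [sub_div] at h2
    linarith
  -- Needed when `s` and `t` round to the same grid point: the diagonal `j = k` is absent from the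
  -- maximum, and the form vanishes there.
  have hstat_lower : 0 ≤ stat + E1 / w 0 := by
    refine le_trans ?_ (hA_lower 0 1 one_pos hfl)
    exact div_nonneg (hB _) (hw_pos _ (hkT 1 hfl)).le
  rw [abs_sub_le_iff]
  have hE2w : 0 ≤ E2 / w 0 := by positivity
  constructor
  · suffices stat ≤ supFunctional B w T h + E1 / w 0 by linarith
    have : Nonempty (Finset.Icc 1 ⌊T * m⌋₊) := ⟨⟨1, Finset.mem_Icc.2 ⟨le_rfl, hfl⟩⟩⟩
    refine ciSup_le fun k => ?_
    obtain ⟨k, hk⟩ := k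
    obtain ⟨hk1, hk⟩ := Finset.mem_Icc.1 hk
    have : Nonempty (Fin k) := ⟨⟨0, hk1⟩⟩
    have hwk := hw_pos _ (hkT k hk)
    rw [div_le_iff₀ hwk]
    refine ciSup_le fun j => ?_
    rw [← div_le_iff₀ hwk]
    obtain ⟨h1, h2, h3, h4⟩ := hgrid j k j.2.le hk
    have h5 := le_supFunctional (B := B) hw_mono hw_pos h1 h2 h3 hN
    rw [h4] at h5
    have h6 := hscale _ E1 _ (hkT k hk) hE10 ((le_abs_self _).trans (hterm j k j.2 hk))
    rw [sub_div] at h6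
    linarith
  · suffices supFunctional B w T h ≤ stat + E1 / w 0 + E2 / w 0 by linarith
    refine supFunctional_le hT fun s t hs hst htT => ?_
    have hms : m ≤ ⌊(m : ℝ) * s⌋₊ := Nat.le_floor (by nlinarith)
    have hfst : ⌊(m : ℝ) * s⌋₊ ≤ ⌊(m : ℝ) * t⌋₊ := Nat.floor_mono (by gcongr)
    obtain ⟨j, hj⟩ := Nat.exists_eq_add_of_le hms
    obtain ⟨k, hk⟩ := Nat.exists_eq_add_of_le (hms.trans hfst)
    have hjk : j ≤ k := by omega
    have hsj : ((m : ℝ) + j) / m ≤ s ∧ s - ((m : ℝ) + j) / m ≤ 1 / m := by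
      have e1 := Nat.floor_le (a := (m : ℝ) * s) (by positivity)
      have e2 := Nat.lt_floor_add_one ((m : ℝ) * s)
      rw [hj] at e1 e2
      push_cast at e1 e2
      rw [div_le_iff₀ hm, sub_le_iff_le_add, ← add_div, le_div_iff₀ hm]
      constructor <;> linarith
    have htk : ((m : ℝ) + k) / m ≤ t ∧ t - ((m : ℝ) + k) / m ≤ 1 / m := by
      have e1 := Nat.floor_le (a := (m : ℝ) * t) (by nlinarith)
      have e2 := Nat.lt_floor_add_one ((m : ℝ) * t)
      rw [hk] at e1 e2
      push_cast at e1 e2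
      rw [div_le_iff₀ hm, sub_le_iff_le_add, ← add_div, le_div_iff₀ hm]
      constructor <;> linarith
    have hkm : k ≤ ⌊T * m⌋₊ := by
      refine Nat.le_floor ?_
      have := htk.1
      rw [div_le_iff₀ hm] at this
      nlinarith
    have hhs : h s = h (((m : ℝ) + j) / m) := by
      rw [← hstep s (by linarith), hj]; push_cast; rfl
    have hht : h t = h (((m : ℝ) + k) / m) := by
      rw [← hstep t (by linarith), hk]; push_cast; rfl
    obtain ⟨h1, h2, h3, h4⟩ := hgrid j k hjk hkm
    set s' := ((m : ℝ) + j) / m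
    set t' := ((m : ℝ) + k) / m
    have hdiff : ‖pathForm h s t - pathForm h s' t'‖ ≤ 2 * N / m := by
      -- The path has the same values at the rounded times, so only the coefficients change, each by
      -- at most `1 / m`.
      have : pathForm h s t - pathForm h s' t' = (t - t') • h s' - (s - s') • h t' := by
        simp only [pathForm, hhs, hht, sub_smul]
        abel
      rw [this]
      refine (norm_sub_le _ _).trans ?_
      rw [norm_smul, norm_smul, Real.norm_of_nonneg (by linarith [htk.1]),
        Real.norm_of_nonneg (by linarith [hsj.1])]
      have e1 : (t - t') * ‖h s'‖ ≤ 1 / m * N := by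
        gcongr
        · exact htk.2
        · exact hN s' ⟨h1, h2.trans h3⟩
      have e2 : (s - s') * ‖h t'‖ ≤ 1 / m * N := by
        gcongr
        · exact hsj.2
        · exact hN t' ⟨h1.trans h2, h3⟩
      calc _ ≤ 1 / (m : ℝ) * N + 1 / m * N := add_le_add e1 e2
        _ = _ := by ring
    have hq := abs_quadForm_sub_quadForm_le B B _ _ (norm_pathForm_le h1 h2 h3 hN) hdiff
    have hq' : quadForm B (pathForm h s t) - quadForm B (pathForm h s' t') ≤ E2 := by
      refine (le_abs_self _).trans (hq.trans_eq ?_)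
      simp [entrySum, hE2, hVdef]
    have ht1 : t - 1 ∈ Set.Icc 0 T := ⟨by linarith, by linarith⟩
    have h6 := hscale _ E2 _ ht1 hE20 hq'
    rw [sub_div] at h6
    suffices quadForm B (pathForm h s' t') / w (t - 1) ≤ stat + E1 / w 0 by linarith
    rcases hjk.eq_or_lt with rfl | hlt
    · simpa [s', t', pathForm_self, quadForm_zero] using hstat_lower
    · refine le_trans ?_ (hA_lower j k hlt hkm)
      -- Rounding `t` down can only decrease `w`, hence only increase the quotient of a nonnegative
      -- form; no continuity of `w` is required.
      refine div_le_div_of_nonneg_left (hB _) (hw_pos _ (hkT k hkm)) ?_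
      refine hw_mono (hkT k hkm) ht1 ?_
      rw [← h4]
      linarith [htk.1]

end

/-! ### The long-run variance is positive semidefinite -/

/-- Enlarging the square of side `k` by the row and column of index `k` adds each lag in `[-k, k]`
exactly once. -/
theorem sum_toeplitz_eq_sum_symm_partialSum (γ : ℤ → ℝ) (n : ℕ) :
    ∑ s ∈ Finset.range n, ∑ t ∈ Finset.range n, γ ((t : ℤ) - s) =
      ∑ k ∈ Finset.range n, ∑ h ∈ Finset.Icc (-(k : ℤ)) k, γ h := by
  have key : ∀ n : ℕ, ∑ h ∈ Finset.Icc (-(n : ℤ)) n, γ h =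
      ∑ s ∈ Finset.range n, γ ((n : ℤ) - s) + ∑ t ∈ Finset.range n, γ ((t : ℤ) - n) + γ 0 := by
    intro n
    induction n with
    | zero => simp
    | succ n ih =>
      have hset : Finset.Icc (-((n + 1 : ℕ) : ℤ)) ((n + 1 : ℕ) : ℤ) =
          insert (-((n : ℤ) + 1)) (insert ((n : ℤ) + 1) (Finset.Icc (-(n : ℤ)) n)) := by
        ext x
        simp only [Finset.mem_Icc, Finset.mem_insert]
        push_cast
        omega
      rw [hset, Finset.sum_insert, Finset.sum_insert, ih, Finset.sum_range_succ' _ n,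
        Finset.sum_range_succ' _ n]
      · push_cast
        simp only [add_sub_add_right_eq_sub, sub_zero, zero_sub]
        ring
      · simp
      · simp only [Finset.mem_insert, Finset.mem_Icc]
        omega
  induction n with
  | zero => simp
  | succ n ih =>
    rw [Finset.sum_range_succ (fun k => ∑ h ∈ Finset.Icc (-(k : ℤ)) k, γ h), ← ih, key n,
      Finset.sum_range_succ]
    simp only [Finset.sum_range_succ, Finset.sum_add_distrib, sub_self]
    ring

section

variable {Ω : Type*} [MeasurableSpace Ω] {P : Measure Ω} {d p : ℕ}
  {X : ℤ → Ω → (Fin d → ℝ)}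

theorem StrictlyStationary.covariance_add (hX : ∀ t, Measurable (X t))
    (hst : StrictlyStationary P X) {f g : (Fin d → ℝ) → ℝ} (hf : Measurable f) (hg : Measurable g)
    (s t h : ℤ) :
    cov[fun ω => f (X (s + h) ω), fun ω => g (X (t + h) ω); P] =
      cov[fun ω => f (X s ω), fun ω => g (X t ω); P] := by
  have hf' : Measurable fun x : ℤ → Fin d → ℝ => f (x s) := hf.comp (measurable_pi_apply s)
  have hg' : Measurable fun x : ℤ → Fin d → ℝ => g (x t) := hg.comp (measurable_pi_apply t)
  have h1 := covariance_map_fun (μ := P) (Z := fun ω (t : ℤ) => X (t + h) ω)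
    hf'.aestronglyMeasurable hg'.aestronglyMeasurable
    (measurable_pi_lambda _ fun t => hX (t + h)).aemeasurable
  have h2 := covariance_map_fun (μ := P) (Z := fun ω (t : ℤ) => X t ω)
    hf'.aestronglyMeasurable hg'.aestronglyMeasurable
    (measurable_pi_lambda _ fun t => hX t).aemeasurable
  rw [← h1, ← h2, hst h]

/-- For a vector `c`, the variance of the sum of `n` consecutive values of `c · f (X t)`, divided by
`n`, is the Cesàro mean of the symmetric partial sums of its autocovariances. It is nonnegative and
converges to `c ⬝ᵥ (S *ᵥ c)`. -/
theorem posSemidef_of_isLongRunVariance [IsProbabilityMeasure P] (hX : ∀ t, Measurable (X t))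
    (hst : StrictlyStationary P X) {f : (Fin d → ℝ) → EuclideanSpace ℝ (Fin p)}
    (hf : Measurable f) {S : Matrix (Fin p) (Fin p) ℝ}
    (hS : IsLongRunVariance P (fun t ω => f (X t ω)) S) : S.PosSemidef := by
  have hfm : ∀ a, Measurable fun x => f x a := fun a => by fun_prop
  have hcov : ∀ (a b : Fin p) (s t : ℤ), cov[fun ω => f (X s ω) a, fun ω => f (X t ω) b; P] =
      cov[fun ω => f (X 0 ω) a, fun ω => f (X (t - s) ω) b; P] := by
    intro a b s t
    have := hst.covariance_add hX (hfm a) (hfm b) 0 (t - s) s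
    rwa [zero_add, sub_add_cancel] at this
  have hmem : ∀ a t, MemLp (fun ω => f (X t ω) a) 2 P := fun a t =>
    (hS.memLp t).eval_piLp a
  refine Matrix.posSemidef_iff_dotProduct_mulVec.2 ⟨?_, fun c => ?_⟩
  · ext a b
    rw [Matrix.conjTranspose_apply, star_trivial]
    -- By stationarity, `t ↦ -t` turns the series for the entry `(a, b)` into the one for `(b, a)`.
    refine tendsto_nhds_unique (hS.tendsto b a) ?_
    refine (hS.tendsto a b).congr fun n => ?_
    refine Finset.sum_nbij' (fun t => -t) (fun t => -t) ?_ ?_ ?_ ?_ ?_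
    · simp only [Finset.mem_Icc]; omega
    · simp only [Finset.mem_Icc]; omega
    · simp
    · simp
    · intro t _
      rw [covariance_comm, hcov b a t 0, zero_sub]
  · rw [star_trivial]
    set Y : ℤ → Ω → ℝ := fun t ω => ∑ a, c a * f (X t ω) a with hY
    set γ : ℤ → ℝ := fun h => ∑ a, ∑ b, c a * c b *
      cov[fun ω => f (X 0 ω) a, fun ω => f (X h ω) b; P] with hγ
    have hYmem : ∀ t, MemLp (Y t) 2 P := fun t =>
      memLp_finsetSum _ fun a _ => (hmem a t).const_mul (c a)
    have hYcov : ∀ s t, cov[Y s, Y t; P] = γ (t - s) := by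
      intro s t
      have e : ∀ t, Y t = ∑ a, fun ω => c a * f (X t ω) a := fun t => by
        ext ω; simp [hY, Finset.sum_apply]
      rw [e, e, covariance_sum_sum (fun a => (hmem a s).const_mul (c a))
        (fun a => (hmem a t).const_mul (c a))]
      refine Finset.sum_congr rfl fun a _ => Finset.sum_congr rfl fun b _ => ?_
      rw [covariance_const_mul_left, covariance_const_mul_right, hcov a b s t]
      ring
    have hlim : Tendsto (fun n : ℕ => ∑ h ∈ Finset.Icc (-(n : ℤ)) n, γ h) atTop
        (𝓝 (c ⬝ᵥ (S *ᵥ c))) := by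
      have h1 : Tendsto (fun n : ℕ => ∑ a, ∑ b, c a * c b *
          ∑ h ∈ Finset.Icc (-(n : ℤ)) n, cov[fun ω => f (X 0 ω) a, fun ω => f (X h ω) b; P]) atTop
          (𝓝 (∑ a, ∑ b, c a * c b * S a b)) :=
        tendsto_finsetSum _ fun a _ => tendsto_finsetSum _ fun b _ =>
          (hS.tendsto a b).const_mul _
      have h2 : ∑ a, ∑ b, c a * c b * S a b = c ⬝ᵥ (S *ᵥ c) := by
        simp only [dotProduct, Matrix.mulVec, Finset.mul_sum]
        exact Finset.sum_congr rfl fun a _ => Finset.sum_congr rfl fun b _ => by ring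
      rw [← h2]
      refine h1.congr fun n => ?_
      simp only [hγ, Finset.mul_sum]
      refine Eq.trans ?_ Finset.sum_comm
      exact Finset.sum_congr rfl fun a _ => Finset.sum_comm
    refine ge_of_tendsto' hlim.cesaro fun n => mul_nonneg (by positivity) ?_
    rw [← sum_toeplitz_eq_sum_symm_partialSum]
    have hvar := variance_sum' (μ := P) (s := Finset.range n) (X := fun s : ℕ => Y s)
      fun s _ => hYmem s
    simp only [hYcov] at hvar
    rw [← hvar]
    exact variance_nonneg _ _

end

/-- The root `R` of `S` is symmetric and invertible, and `R * S⁻¹ * R = 1`. -/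
theorem quadForm_inv_sqrt_mulVec {p : ℕ} {S : Matrix (Fin p) (Fin p) ℝ} (hS : S.PosSemidef)
    (hdet : S.det ≠ 0) (v : Fin p → ℝ) :
    quadForm S⁻¹ (WithLp.toLp 2 (CFC.sqrt S *ᵥ v)) = v ⬝ᵥ v := by
  have hR : CFC.sqrt S * CFC.sqrt S = S := CFC.sqrt_mul_sqrt_self S hS.nonneg
  have hRH : (CFC.sqrt S)ᵀ = CFC.sqrt S := by
    have := (Matrix.nonneg_iff_posSemidef.1 (CFC.sqrt_nonneg S)).isHermitian
    simpa [Matrix.IsHermitian] using this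
  have hRdet : IsUnit (CFC.sqrt S).det := by
    have := congrArg Matrix.det hR
    rw [Matrix.det_mul] at this
    rw [isUnit_iff_ne_zero]
    rintro h0
    simp [h0] at this
    exact hdet this.symm
  have hinv : CFC.sqrt S * S⁻¹ * CFC.sqrt S = 1 := by
    have h1 : S⁻¹ = (CFC.sqrt S)⁻¹ * (CFC.sqrt S)⁻¹ := by
      conv_lhs => rw [← hR, Matrix.mul_inv_rev]
    rw [h1, ← mul_assoc, Matrix.mul_nonsing_inv _ hRdet, one_mul, Matrix.nonsing_inv_mul _ hRdet]
  have hv : CFC.sqrt S *ᵥ v = v ᵥ* CFC.sqrt S := by rw [← Matrix.vecMul_transpose, hRH]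
  calc quadForm S⁻¹ (WithLp.toLp 2 (CFC.sqrt S *ᵥ v))
      = (v ᵥ* CFC.sqrt S) ⬝ᵥ (S⁻¹ *ᵥ (CFC.sqrt S *ᵥ v)) := by rw [← hv]; rfl
    _ = v ⬝ᵥ v := by
      rw [← Matrix.dotProduct_mulVec, Matrix.mulVec_mulVec, Matrix.mulVec_mulVec, hinv, Matrix.one_mulVec]

/-! ### The limit variable has no atom at one -/

/-- A supremum of uniformly strictly convex quadratic polynomials takes each value finitely
often. -/
theorem finite_setOf_isLUB_quadratic {ι : Type*} {κ : ℝ} (hκ : 0 < κ) (a b c : ι → ℝ)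
    (ha : ∀ i, κ ≤ a i) :
    {x : ℝ | (∀ i, a i * x ^ 2 + b i * x + c i ≤ 1) ∧
      ∀ n : ℕ, ∃ i, 1 - 1 / ((n : ℝ) + 1) < a i * x ^ 2 + b i * x + c i}.Finite := by
  by_contra hinf
  obtain ⟨s, hs, hcard⟩ := Set.Infinite.exists_subset_card_eq hinf 3
  have hmem : ∀ i, s.orderEmbOfFin hcard i ∈ s := fun i => Finset.orderEmbOfFin_mem _ _ i
  set x := s.orderEmbOfFin hcard 0
  set y := s.orderEmbOfFin hcard 1
  set z := s.orderEmbOfFin hcard 2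
  have hxy : x < y := (s.orderEmbOfFin hcard).strictMono (by decide)
  have hyz : y < z := (s.orderEmbOfFin hcard).strictMono (by decide)
  have hx := (hs (hmem 0)).1
  have hy := (hs (hmem 1)).2
  have hz := (hs (hmem 2)).1
  -- For three points `x < y < z` of the set, this is the least amount by which convexity forces
  -- every quadratic below `1` at `y`, given that it is at most `1` at `x` and `z`. It contradicts a
  -- supremum of `1` at `y`.
  have hε : 0 < κ * (y - x) * (z - y) := by
    have := sub_pos.2 hxy
    have := sub_pos.2 hyz
    positivity
  obtain ⟨n, hn⟩ := exists_nat_one_div_lt hε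
  obtain ⟨i, hi⟩ := hy n
  have hxi := hx i
  have hzi := hz i
  have key : (z - x) * (a i * y ^ 2 + b i * y + c i) =
      (z - y) * (a i * x ^ 2 + b i * x + c i) + (y - x) * (a i * z ^ 2 + b i * z + c i) -
        a i * (y - x) * (z - y) * (z - x) := by ring
  have h1 : (z - y) * (a i * x ^ 2 + b i * x + c i) ≤ (z - y) * 1 :=
    mul_le_mul_of_nonneg_left hxi (by linarith)
  have h2 : (y - x) * (a i * z ^ 2 + b i * z + c i) ≤ (y - x) * 1 :=
    mul_le_mul_of_nonneg_left hzi (by linarith)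
  have h3 : κ * (y - x) * (z - y) * (z - x) ≤ a i * (y - x) * (z - y) * (z - x) := by
    have := sub_pos.2 hxy
    have := sub_pos.2 hyz
    have : 0 < z - x := by linarith
    have := ha i
    gcongr
  have h4 : (z - x) * (a i * y ^ 2 + b i * y + c i) ≤ (z - x) * (1 - κ * (y - x) * (z - y)) := by
    rw [key]; linarith
  have h5 := le_of_mul_le_mul_left h4 (by linarith)
  linarith

section

variable {Ω : Type*} [MeasurableSpace Ω] {P : Measure Ω} [IsProbabilityMeasure P]

/-- Fubini: for fixed `Y` the exceptional values of `ξ` form a finite set, which is null for the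
atomless law of `ξ`. Countability of `ι` makes the event measurable. -/
theorem ae_not_isLUB_quadratic {𝓨 ι : Type*} [MeasurableSpace 𝓨] [Countable ι] {Y : Ω → 𝓨}
    {ξ : Ω → ℝ} (hY : AEMeasurable Y P) (hξ : AEMeasurable ξ P) (hind : IndepFun Y ξ P)
    [NullSingletonClass (P.map ξ)] {κ : ℝ} (hκ : 0 < κ) (a : ι → ℝ) (ha : ∀ i, κ ≤ a i)
    (b c : ι → 𝓨 → ℝ) (hb : ∀ i, Measurable (b i)) (hc : ∀ i, Measurable (c i)) :
    ∀ᵐ ω ∂P, ¬ ((∀ i, a i * ξ ω ^ 2 + b i (Y ω) * ξ ω + c i (Y ω) ≤ 1) ∧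
      ∀ n : ℕ, ∃ i, 1 - 1 / ((n : ℝ) + 1) < a i * ξ ω ^ 2 + b i (Y ω) * ξ ω + c i (Y ω)) := by
  set s : Set (𝓨 × ℝ) := {q | (∀ i, a i * q.2 ^ 2 + b i q.1 * q.2 + c i q.1 ≤ 1) ∧
      ∀ n : ℕ, ∃ i, 1 - 1 / ((n : ℝ) + 1) < a i * q.2 ^ 2 + b i q.1 * q.2 + c i q.1} with hs
  have hm : ∀ i, Measurable fun q : 𝓨 × ℝ => a i * q.2 ^ 2 + b i q.1 * q.2 + c i q.1 := by
    intro i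
    have := hb i
    have := hc i
    fun_prop
  have hsm : MeasurableSet s := by
    have : s = (⋂ i, {q | a i * q.2 ^ 2 + b i q.1 * q.2 + c i q.1 ≤ 1}) ∩
        ⋂ n : ℕ, ⋃ i, {q | 1 - 1 / ((n : ℝ) + 1) < a i * q.2 ^ 2 + b i q.1 * q.2 + c i q.1} := by
      ext q
      simp [hs]
    rw [this]
    refine (MeasurableSet.iInter fun i => measurableSet_le (hm i) measurable_const).inter ?_
    exact MeasurableSet.iInter fun n => MeasurableSet.iUnion fun i =>
      measurableSet_lt measurable_const (hm i)
  have hprob : IsProbabilityMeasure (P.map ξ) := Measure.isProbabilityMeasure_map hξ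
  have h0 : ((P.map Y).prod (P.map ξ)) s = 0 := by
    refine (Measure.measure_prod_null hsm).2 (Eventually.of_forall fun y => ?_)
    exact (finite_setOf_isLUB_quadratic hκ a (fun i => b i y) (fun i => c i y) ha).measure_zero _
  rw [← (indepFun_iff_map_prod_eq_prod_map_map hY hξ).1 hind] at h0
  exact ae_iff.2 (by
    have := (Measure.map_apply_of_aemeasurable (hY.prodMk hξ) hsm).symm.trans h0
    simpa [hs] using this)

/-- The two hypotheses make the joint law of `G`, `ξ`, `O` a threefold product, whose factors may be
regrouped. -/
theorem indepFun_prodMk_left_of_prodMk {α β γ : Type*} [MeasurableSpace α] [MeasurableSpace β]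
    [MeasurableSpace γ] {G : Ω → α} {ξ : Ω → β} {O : Ω → γ} (hG : AEMeasurable G P)
    (hξ : AEMeasurable ξ P) (hO : AEMeasurable O P) (h1 : IndepFun G ξ P)
    (h2 : IndepFun (fun ω => (G ω, ξ ω)) O P) : IndepFun (fun ω => (G ω, O ω)) ξ P := by
  have hGO : IndepFun G O P := h2.comp measurable_fst measurable_id
  have e1 := (indepFun_iff_map_prod_eq_prod_map_map hG hξ).1 h1
  have e2 := (indepFun_iff_map_prod_eq_prod_map_map (hG.prodMk hξ) hO).1 h2
  have e3 := (indepFun_iff_map_prod_eq_prod_map_map hG hO).1 hGO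
  rw [indepFun_iff_map_prod_eq_prod_map_map (hG.prodMk hO) hξ, e3]
  rw [e1] at e2
  have := Measure.isProbabilityMeasure_map hG
  have := Measure.isProbabilityMeasure_map hξ
  have := Measure.isProbabilityMeasure_map hO
  have hφ : Measurable fun q : (α × β) × γ => ((q.1.1, q.2), q.1.2) := by fun_prop
  have e4 : P.map (fun ω => ((G ω, O ω), ξ ω)) =
      (((P.map G).prod (P.map ξ)).prod (P.map O)).map fun q => ((q.1.1, q.2), q.1.2) := by
    rw [← e2, AEMeasurable.map_map_of_aemeasurable hφ.aemeasurable ((hG.prodMk hξ).prodMk hO)]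
    rfl
  rw [e4]
  have h3 := (measurePreserving_prodAssoc (P.map G) (P.map O) (P.map ξ)).symm
  have h4 := (MeasurePreserving.id (P.map G)).prod
    (Measure.measurePreserving_swap (μ := P.map ξ) (ν := P.map O))
  exact (h3.comp (h4.comp (measurePreserving_prodAssoc (P.map G) (P.map ξ) (P.map O)))).map_eq

end

theorem quadForm_one {p : ℕ} (v : EuclideanSpace ℝ (Fin p)) :
    quadForm 1 v = v.ofLp ⬝ᵥ v.ofLp := by
  simp [quadForm]

theorem quadForm_one_eq_sum_sq {p : ℕ} (v : EuclideanSpace ℝ (Fin p)) :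
    quadForm 1 v = ∑ a, v a ^ 2 := by
  simp [quadForm, dotProduct, sq]

theorem limitStat_eq_supFunctional {Ω' : Type*} {p : ℕ} (W : ℝ≥0 → Ω' → EuclideanSpace ℝ (Fin p))
    (T : ℝ) (w : ℝ → ℝ) (ω : Ω') :
    limitStat W T w ω = supFunctional 1 w T fun s => W s.toNNReal ω := by
  simp only [limitStat, supFunctional, quadForm_one]
  rfl

theorem IsStandardBrownianMotion.ae_continuous {Ω' : Type*} [MeasurableSpace Ω'] {P' : Measure Ω'}
    {p : ℕ} {W : ℝ≥0 → Ω' → EuclideanSpace ℝ (Fin p)} (hW : IsStandardBrownianMotion W P') :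
    ∀ᵐ ω ∂P', Continuous fun t => W t ω := by
  have h : ∀ᵐ ω ∂P', ∀ a, Continuous fun t => W t ω a :=
    ae_all_iff.2 fun a => (hW.isBrownianReal a).cont
  filter_upwards [h] with ω hω
  exact (PiLp.continuous_toLp 2 _).comp (continuous_pi hω)

/-- Increments after time one of one component of a Brownian motion, together with all other
components after time one, are independent of the value of that component at time one. -/
theorem IsStandardBrownianMotion.indepFun_eval_one {Ω' : Type*} [MeasurableSpace Ω']
    {P' : Measure Ω'} [IsProbabilityMeasure P'] {p : ℕ}
    {W : ℝ≥0 → Ω' → EuclideanSpace ℝ (Fin p)} (hW : IsStandardBrownianMotion W P') (a : Fin p) :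
    IndepFun (fun ω => ((fun q : ℚ≥0 => W (1 + (q : ℝ≥0)) ω a - W 1 ω a),
      fun (b : (Finset.univ.erase a : Finset (Fin p))) (q : ℚ≥0) => W (1 + (q : ℝ≥0)) ω b))
      (fun ω => W 1 ω a) P' := by
  have hm : ∀ t a, AEMeasurable (fun ω => W t ω a) P' := fun t a =>
    (hW.isBrownianReal a).toIsPreBrownianReal.aemeasurable t
  have hG : AEMeasurable (fun ω => fun q : ℚ≥0 => W (1 + (q : ℝ≥0)) ω a - W 1 ω a) P' :=
    aemeasurable_pi_lambda _ fun q => (hm _ a).sub (hm _ a)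
  have hU : ∀ b, AEMeasurable (fun ω => fun q : ℚ≥0 => W (1 + (q : ℝ≥0)) ω b) P' := fun b =>
    aemeasurable_pi_lambda _ fun q => hm _ b
  refine indepFun_prodMk_left_of_prodMk hG (hm 1 a)
    (aemeasurable_pi_lambda _ fun b => hU b) ?_ ?_
  -- Independence of the increments after time one from the path up to time one.
  · have h := (hW.isBrownianReal a).toIsPreBrownianReal.indepFun_shift 1
    have hψ : Measurable fun x : Set.Iic (1 : ℝ≥0) → ℝ => x ⟨1, Set.mem_Iic.2 le_rfl⟩ :=
      measurable_pi_apply _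
    exact h.comp (φ := fun x (q : ℚ≥0) => x (q : ℝ≥0))
      (ψ := fun x : Set.Iic (1 : ℝ≥0) → ℝ => x ⟨1, Set.mem_Iic.2 le_rfl⟩)
      (measurable_pi_lambda _ fun q => measurable_pi_apply _)
      hψ
  -- Independence of the components; the increments and the value at time one are both read off
  -- component `a`, the latter at `q = 0`.
  · have h := hW.indep.comp (fun _ x (q : ℚ≥0) => x (1 + (q : ℝ≥0)))
      (fun _ => measurable_pi_lambda _ fun q => measurable_pi_apply _)
    have h2 := h.indepFun_finset₀ {a} (Finset.univ.erase a) (by simp) hU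
    have := h2.comp
      (φ := fun x : ({a} : Finset (Fin p)) → ℚ≥0 → ℝ => ((fun q : ℚ≥0 => x ⟨a, by simp⟩ q - x ⟨a, by simp⟩ 0), x ⟨a, by simp⟩ 0))
      (ψ := fun x => x) (by fun_prop) measurable_id
    simpa [Function.comp_def] using this

section

variable {Ω' : Type*} [MeasurableSpace Ω'] {P' : Measure Ω'} [IsProbabilityMeasure P'] {p : ℕ}
  {W : ℝ≥0 → Ω' → EuclideanSpace ℝ (Fin p)} {T : ℝ} {w : ℝ → ℝ}

/-- Over pairs of rational times which are separated by a fixed amount, the supremum of the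
normalized squared bridge is almost surely different from one. -/
theorem IsStandardBrownianMotion.ae_not_isLUB_bridge (hW : IsStandardBrownianMotion W P')
    (a : Fin p) (hT : 0 ≤ T) (hw_mono : MonotoneOn w (Set.Icc 0 T))
    (hw_pos : ∀ x ∈ Set.Icc 0 T, 0 < w x) {δ : ℝ} (hδ : 0 < δ) :
    ∀ᵐ ω ∂P', ¬ ((∀ i : {q : ℚ≥0 × ℚ≥0 // (q.1 : ℝ) + δ ≤ q.2 ∧ (q.2 : ℝ) ≤ T},
        quadForm 1 (bridge W (1 + i.1.1) (1 + i.1.2) ω) / w i.1.2 ≤ 1) ∧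
      ∀ n : ℕ, ∃ i : {q : ℚ≥0 × ℚ≥0 // (q.1 : ℝ) + δ ≤ q.2 ∧ (q.2 : ℝ) ≤ T},
        1 - 1 / ((n : ℝ) + 1) < quadForm 1 (bridge W (1 + i.1.1) (1 + i.1.2) ω) / w i.1.2) := by
  have hTT : T ∈ Set.Icc 0 T := ⟨hT, le_rfl⟩
  have hm : ∀ t a, AEMeasurable (fun ω => W t ω a) P' := fun t a =>
    (hW.isBrownianReal a).toIsPreBrownianReal.aemeasurable t
  have hlaw := ((hW.isBrownianReal a).toIsPreBrownianReal.hasLaw_eval 1).map_eq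
  have : NullSingletonClass (P'.map fun ω => W 1 ω a) := by
    rw [hlaw]
    exact nullSingletonClass_gaussianReal one_ne_zero
  have key := ae_not_isLUB_quadratic
    (ι := {q : ℚ≥0 × ℚ≥0 // (q.1 : ℝ) + δ ≤ q.2 ∧ (q.2 : ℝ) ≤ T})
    (Y := fun ω => ((fun q : ℚ≥0 => W (1 + (q : ℝ≥0)) ω a - W 1 ω a),
      fun (b : (Finset.univ.erase a : Finset (Fin p))) (q : ℚ≥0) => W (1 + (q : ℝ≥0)) ω b))
    ((aemeasurable_pi_lambda _ fun q => (hm _ a).sub (hm _ a)).prodMk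
      (aemeasurable_pi_lambda _ fun b => aemeasurable_pi_lambda _ fun q => hm _ b))
    -- The leading coefficient `(y - x) ^ 2 / w y` is at least `δ ^ 2 / w T`, since `y - x ≥ δ` and
    -- `w y ≤ w T`.
    (hm 1 a) (hW.indepFun_eval_one a) (κ := δ ^ 2 / w T) (div_pos (by positivity) (hw_pos T hTT))
    (fun i => ((i.1.2 : ℝ) - i.1.1) ^ 2 / w i.1.2) ?_
    (fun i y => 2 * ((i.1.2 : ℝ) - i.1.1) * ((1 + i.1.2) * y.1 i.1.1 - (1 + i.1.1) * y.1 i.1.2) /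
      w i.1.2)
    (fun i y => (((1 + i.1.2) * y.1 i.1.1 - (1 + i.1.1) * y.1 i.1.2) ^ 2 +
      ∑ b : (Finset.univ.erase a : Finset (Fin p)),
        ((1 + i.1.2) * y.2 b i.1.1 - (1 + i.1.1) * y.2 b i.1.2) ^ 2) / w i.1.2)
    (fun i => by fun_prop) (fun i => by fun_prop)
  · refine key.mono fun ω hω => ?_
    have hpoly : ∀ x y : ℚ≥0, quadForm 1 (bridge W (1 + x) (1 + y) ω) / w y =
        ((y : ℝ) - x) ^ 2 / w y * W 1 ω a ^ 2 + 2 * ((y : ℝ) - x) *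
          ((1 + y) * (W (1 + (x : ℝ≥0)) ω a - W 1 ω a) -
            (1 + x) * (W (1 + (y : ℝ≥0)) ω a - W 1 ω a)) / w y * W 1 ω a +
        (((1 + y) * (W (1 + (x : ℝ≥0)) ω a - W 1 ω a) -
            (1 + x) * (W (1 + (y : ℝ≥0)) ω a - W 1 ω a)) ^ 2 +
          ∑ b : (Finset.univ.erase a : Finset (Fin p)),
            ((1 + y) * W (1 + (x : ℝ≥0)) ω b - (1 + x) * W (1 + (y : ℝ≥0)) ω b) ^ 2) / w y := by
      intro x y
      have e : ∀ x : ℚ≥0, (1 + (x : ℝ)).toNNReal = 1 + (x : ℝ≥0) := fun x => by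
        rw [Real.toNNReal_add zero_le_one (by positivity), Real.toNNReal_one,
          show (x : ℝ) = ((x : ℝ≥0) : ℝ) from (map_nnratCast NNReal.toRealHom x).symm,
          Real.toNNReal_coe]
      rw [quadForm_one_eq_sum_sq, ← Finset.add_sum_erase _ _ (Finset.mem_univ a),
        ← Finset.sum_coe_sort (Finset.univ.erase a)]
      simp only [bridge, e, PiLp.sub_apply, PiLp.smul_apply, smul_eq_mul]
      ring
    simp only [hpoly]
    exact hω
  · intro i
    have h2 : (i.1.2 : ℝ) ∈ Set.Icc 0 T := ⟨by positivity, i.2.2⟩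
    refine div_le_div₀ (by positivity) ?_ (hw_pos _ h2) (hw_mono h2 hTT i.2.2)
    have := i.2.1
    gcongr
    linarith

theorem exists_norm_le_of_continuous {h : ℝ → EuclideanSpace ℝ (Fin p)} (hh : Continuous h)
    (T : ℝ) : ∃ N, ∀ s ∈ Set.Icc (1 : ℝ) (T + 1), ‖h s‖ ≤ N :=
  isCompact_Icc.exists_bound_of_continuousOn hh.continuousOn

theorem quadForm_one_nonneg (v : EuclideanSpace ℝ (Fin p)) : 0 ≤ quadForm 1 v := by
  rw [quadForm_one_eq_sum_sq]
  positivity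

/-- If the supremum along a continuous path equals one, then it is already approached over pairs
of rational times which are separated by a fixed amount. -/
theorem exists_isLUB_of_supFunctional_eq_one {h : ℝ → EuclideanSpace ℝ (Fin p)}
    (hh : Continuous h) (hT : 0 ≤ T) (hw_mono : MonotoneOn w (Set.Icc 0 T))
    (hw_pos : ∀ x ∈ Set.Icc 0 T, 0 < w x) (h1 : supFunctional 1 w T h = 1) :
    ∃ n : ℕ, (∀ i : {q : ℚ≥0 × ℚ≥0 // (q.1 : ℝ) + 1 / ((n : ℝ) + 1) ≤ q.2 ∧ (q.2 : ℝ) ≤ T},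
        quadForm 1 (pathForm h (1 + i.1.1) (1 + i.1.2)) / w i.1.2 ≤ 1) ∧
      ∀ k : ℕ, ∃ i : {q : ℚ≥0 × ℚ≥0 // (q.1 : ℝ) + 1 / ((n : ℝ) + 1) ≤ q.2 ∧ (q.2 : ℝ) ≤ T},
        1 - 1 / ((k : ℝ) + 1) < quadForm 1 (pathForm h (1 + i.1.1) (1 + i.1.2)) / w i.1.2 := by
  obtain ⟨N, hN⟩ := exists_norm_le_of_continuous hh T
  have hF : Continuous fun q : ℝ × ℝ => quadForm 1 (pathForm h q.1 q.2) := by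
    simp only [quadForm_one_eq_sum_sq, pathForm]
    fun_prop
  have h0 : (0 : ℝ) ∈ Set.Icc 0 T := ⟨le_rfl, hT⟩
  have hw0 := hw_pos 0 h0
  obtain ⟨δ, hδ, hδ'⟩ := Metric.uniformContinuousOn_iff.1
    ((isCompact_Icc (a := (1 : ℝ)) (b := T + 1)).prod
      (isCompact_Icc (a := (1 : ℝ)) (b := T + 1)) |>.uniformContinuousOn_of_continuous
      hF.continuousOn) (w 0 / 2) (by positivity)
  -- The form vanishes on the diagonal, so by uniform continuity it stays below `w 0 / 2` within
  -- distance `δ` of it.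
  have hdiag : ∀ s t : ℝ, 1 ≤ s → s ≤ t → t ≤ T + 1 →
      1 / 2 < quadForm 1 (pathForm h s t) / w (t - 1) → δ ≤ t - s := by
    intro s t hs hst ht hlt
    by_contra! hcon
    have ht1 : t - 1 ∈ Set.Icc 0 T := ⟨by linarith, by linarith⟩
    have := hδ' (s, t) ⟨⟨hs, hst.trans ht⟩, ⟨hs.trans hst, ht⟩⟩ (t, t)
      ⟨⟨hs.trans hst, ht⟩, ⟨hs.trans hst, ht⟩⟩ (by
        rw [Prod.dist_eq, dist_self, Real.dist_eq, max_eq_left (abs_nonneg _), abs_sub_comm,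
          abs_of_nonneg (by linarith)]
        exact hcon)
    simp only [pathForm_self, quadForm_zero, Real.dist_eq, sub_zero] at this
    have h2 := div_le_div₀ (by positivity) ((le_abs_self _).trans this.le) hw0
      (hw_mono h0 ht1 ht1.1)
    rw [div_div, mul_comm, ← div_div, div_self hw0.ne'] at h2
    linarith
  obtain ⟨n, hn⟩ := exists_nat_one_div_lt hδ
  refine ⟨n, fun i => ?_, fun k => ?_⟩
  · have hx : (0 : ℝ) ≤ (i.1.1 : ℝ) := by positivity
    have hn0 : (0 : ℝ) < 1 / ((n : ℝ) + 1) := by positivity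
    have h2 := i.2.1
    have h3 := i.2.2
    have := le_supFunctional (B := 1) (s := 1 + i.1.1) (t := 1 + i.1.2) hw_mono hw_pos
      (by linarith) (by linarith) (by linarith) hN
    rwa [h1, add_sub_cancel_left] at this
  · have hk0 : (0 : ℝ) < 1 / ((k : ℝ) + 1) := by positivity
    -- The floor `1 / 2` makes `hdiag` applicable both to `(s, t)` and to its rational
    -- approximation.
    set c := max (1 - 1 / ((k : ℝ) + 1)) (1 / 2) with hc
    have hc1 : c < 1 := max_lt (by linarith) (by norm_num)
    obtain ⟨s, t, hs, hst, htT, hlt⟩ : ∃ s t : ℝ, 1 ≤ s ∧ s ≤ t ∧ t ≤ T + 1 ∧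
        c < quadForm 1 (pathForm h s t) / w (t - 1) := by
      by_contra! hcon
      have := supFunctional_le (B := 1) hT hcon
      linarith
    have hts := hdiag s t hs hst htT ((le_max_right _ _).trans_lt hlt)
    have ht1 : t - 1 ∈ Set.Icc 0 T := ⟨by linarith, by linarith⟩
    -- The weight is frozen at `t - 1` because `w` may jump. The rational `y` is then taken below `t
    -- - 1`, so that passing to `w y` only increases the quotient.
    have hcont : Continuous fun q : ℝ × ℝ =>
        quadForm 1 (pathForm h (1 + q.1) (1 + q.2)) / w (t - 1) :=
      (hF.comp (f := fun q : ℝ × ℝ => (1 + q.1, 1 + q.2)) (by fun_prop)).div_const _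
    have hev : ∀ᶠ q : ℝ × ℝ in 𝓝 (s - 1, t - 1),
        c < quadForm 1 (pathForm h (1 + q.1) (1 + q.2)) / w (t - 1) := by
      refine hcont.continuousAt.eventually (lt_mem_nhds ?_)
      simpa using hlt
    obtain ⟨r, hr, hball⟩ := Metric.eventually_nhds_iff.1 hev
    obtain ⟨y, hy1, hy2⟩ := exists_rat_btwn (show max (s - 1) (t - 1 - r) < t - 1 from
      max_lt (by linarith) (by linarith))
    obtain ⟨hsy, hry⟩ := max_lt_iff.1 hy1
    obtain ⟨x, hx1, hx2⟩ := exists_rat_btwn (show s - 1 < min (s - 1 + r) y from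
      lt_min (by linarith) hsy)
    obtain ⟨hxr, hxy⟩ := lt_min_iff.1 hx2
    have hx0 : (0 : ℝ) ≤ x := by linarith
    have hy0 : (0 : ℝ) ≤ y := by linarith
    lift x to ℚ≥0 using (by exact_mod_cast hx0)
    lift y to ℚ≥0 using (by exact_mod_cast hy0)
    have ex : ((x : ℚ) : ℝ) = x := by norm_cast
    have ey : ((y : ℚ) : ℝ) = y := by norm_cast
    rw [ex] at hx1 hxr hx0 hxy
    rw [ey] at hy2 hsy hry hy0 hxy
    have h2 := hball (y := ((x : ℝ), (y : ℝ))) (by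
      rw [Prod.dist_eq]
      refine max_lt ?_ ?_
      · rw [Real.dist_eq, abs_lt]; constructor <;> simp only <;> linarith
      · rw [Real.dist_eq, abs_lt]; constructor <;> simp only <;> linarith)
    have hyT : (y : ℝ) ∈ Set.Icc 0 T := ⟨hy0, by linarith [ht1.2]⟩
    have h3 : c < quadForm 1 (pathForm h (1 + x) (1 + y)) / w y :=
      h2.trans_le (div_le_div_of_nonneg_left (quadForm_one_nonneg _) (hw_pos _ hyT)
        (hw_mono hyT ht1 hy2.le))
    have h4 := hdiag (1 + x) (1 + y) (by linarith) (by linarith) (by linarith [hyT.2])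
      (by rw [add_sub_cancel_left]; exact (le_max_right _ _).trans_lt h3)
    exact ⟨⟨(x, y), by linarith, hyT.2⟩, (le_max_left _ _).trans_lt h3⟩

theorem IsStandardBrownianMotion.measure_limitStat_eq_one (hW : IsStandardBrownianMotion W P')
    (hT : 0 ≤ T) (hw_mono : MonotoneOn w (Set.Icc 0 T)) (hw_pos : ∀ x ∈ Set.Icc 0 T, 0 < w x) :
    P' {ω | limitStat W T w ω = 1} = 0 := by
  suffices h : ∀ᵐ ω ∂P', ¬ limitStat W T w ω = 1 by simpa using ae_iff.1 h
  -- For `p = 0` there is no Gaussian coordinate, but the limit variable is then at most `0`.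
  rcases isEmpty_or_nonempty (Fin p) with hp | ⟨⟨a⟩⟩
  · refine Eventually.of_forall fun ω h1 => ?_
    rw [limitStat_eq_supFunctional] at h1
    have := supFunctional_le (B := 1) (w := w) (h := fun s => W s.toNNReal ω) (c := 0) hT
      fun s t _ _ _ => by simp [quadForm_one_eq_sum_sq]
    linarith
  · have hn : ∀ᵐ ω ∂P', ∀ n : ℕ, _ := ae_all_iff.2 fun n : ℕ =>
      hW.ae_not_isLUB_bridge a hT hw_mono hw_pos (δ := 1 / ((n : ℝ) + 1)) (by positivity)
    filter_upwards [hW.ae_continuous, hn] with ω hc hn h1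
    rw [limitStat_eq_supFunctional] at h1
    obtain ⟨n, h⟩ := exists_isLUB_of_supFunctional_eq_one
      (hc.comp continuous_real_toNNReal) hT hw_mono hw_pos h1
    exact hn n h

end

/-! ### Convergence in probability -/

section

variable {Ω Ω' : Type*} [MeasurableSpace Ω] [MeasurableSpace Ω'] {P : Measure Ω}
  {P' : Measure Ω'} [IsProbabilityMeasure P']

theorem exists_measure_setOf_le_lt {N : Ω' → ℝ} (hN : AEMeasurable N P') {ε : ℝ≥0∞} (hε : 0 < ε) :
    ∃ K : ℝ, P' {ω | K ≤ N ω} < ε := by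
  have h := tendsto_measure_iInter_atTop (μ := P') (s := fun k : ℕ => {ω | (k : ℝ) ≤ N ω})
    (fun k => nullMeasurableSet_le aemeasurable_const hN)
    (fun k l hkl ω (hω : (l : ℝ) ≤ N ω) => (Nat.cast_le.2 hkl).trans hω) ⟨0, measure_ne_top _ _⟩
  have h0 : ⋂ k : ℕ, {ω | (k : ℝ) ≤ N ω} = ∅ := by
    refine Set.eq_empty_of_forall_notMem fun ω hω => ?_
    obtain ⟨k, hk⟩ := exists_nat_gt (N ω)
    exact absurd (Set.mem_iInter.1 hω k) (not_le.2 hk)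
  rw [h0, measure_empty] at h
  obtain ⟨k, hk⟩ := (h.eventually (gt_mem_nhds hε)).exists
  exact ⟨k, hk⟩

/-- A sequence of real random variables which converges in distribution is tight. -/
theorem exists_eventually_measure_setOf_le_lt [IsProbabilityMeasure P] {N : ℕ → Ω → ℝ} {N' : Ω' → ℝ}
    (h : TendstoInDistribution N atTop N' (fun _ => P) P') {ε : ℝ≥0∞} (hε : 0 < ε) :
    ∃ K : ℝ, ∀ᶠ m in atTop, P {ω | K ≤ N m ω} < ε := by
  obtain ⟨K, hK⟩ := exists_measure_setOf_le_lt h.aemeasurable_limit hε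
  refine ⟨K, ?_⟩
  have h1 := ProbabilityMeasure.limsup_measure_closed_le_of_tendsto h.tendsto
    (isClosed_Ici (a := K))
  simp only [ProbabilityMeasure.coe_mk] at h1
  rw [Measure.map_apply_of_aemeasurable h.aemeasurable_limit measurableSet_Ici] at h1
  filter_upwards [eventually_lt_of_limsup_lt (h1.trans_lt hK)] with m hm
  rwa [Measure.map_apply_of_aemeasurable (h.forall_aemeasurable m) measurableSet_Ici] at hm

/-- A sequence which is small wherever a tight sequence is bounded and two null sequences are
small tends to zero in probability. -/
theorem tendstoInMeasure_zero_of_tight {N x y D : ℕ → Ω → ℝ}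
    (hN : ∀ ε : ℝ≥0∞, 0 < ε → ∃ K : ℝ, ∀ᶠ m in atTop, P {ω | K ≤ N m ω} < ε)
    (hx : TendstoInMeasure P x atTop fun _ => 0) (hy : TendstoInMeasure P y atTop fun _ => 0)
    (hD : ∀ K ε : ℝ, 0 < ε → ∃ δ > 0, ∀ᶠ m in atTop, ∀ ω, N m ω < K → |x m ω| < δ →
      |y m ω| < δ → |D m ω| < ε) : TendstoInMeasure P D atTop fun _ => 0 := by
  rw [tendstoInMeasure_iff_norm] at hx hy ⊢
  intro ε hε
  rw [ENNReal.tendsto_nhds_zero]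
  intro η hη
  have hη3 : 0 < η / 3 := ENNReal.div_pos hη.ne' (by norm_num)
  obtain ⟨K, hK⟩ := hN (η / 3) hη3
  obtain ⟨δ, hδ, hDδ⟩ := hD K ε hε
  filter_upwards [hK, hDδ, (ENNReal.tendsto_nhds_zero.1 (hx δ hδ)) _ hη3,
    (ENNReal.tendsto_nhds_zero.1 (hy δ hδ)) _ hη3] with m h1 h2 h3 h4
  calc P {ω | ε ≤ ‖D m ω - 0‖}
      ≤ P ({ω | K ≤ N m ω} ∪ {ω | δ ≤ ‖x m ω - 0‖} ∪ {ω | δ ≤ ‖y m ω - 0‖}) := by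
        refine measure_mono fun ω hω => ?_
        by_contra hcon
        simp only [Set.mem_union, Set.mem_ofPred_eq, not_or, not_le, sub_zero,
          Real.norm_eq_abs] at hcon hω
        exact absurd (h2 ω hcon.1.1 hcon.1.2 hcon.2) (not_lt.2 hω)
    _ ≤ η / 3 + η / 3 + η / 3 :=
        (measure_union_le _ _).trans (add_le_add ((measure_union_le _ _).trans
          (add_le_add h1.le h3)) h4)
    _ = η := ENNReal.add_thirds η

/-- A continuous function of matrices which converge in probability entry by entry. -/
theorem tendstoInMeasure_comp_matrix {p : ℕ} {A : ℕ → Ω → Matrix (Fin p) (Fin p) ℝ}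
    {S : Matrix (Fin p) (Fin p) ℝ}
    (hA : ∀ a b, TendstoInMeasure P (fun m ω => A m ω a b) atTop fun _ => S a b)
    {F : Matrix (Fin p) (Fin p) ℝ → ℝ} (hF : ContinuousAt F S) :
    TendstoInMeasure P (fun m ω => F (A m ω)) atTop fun _ => F S := by
  simp only [tendstoInMeasure_iff_norm] at hA ⊢
  intro ε hε
  have hof : Continuous fun M : Fin p → Fin p → ℝ => Matrix.of M :=
    continuous_matrix fun a b => (continuous_apply b).comp (continuous_apply a)
  -- In the sup metric of `Fin p → Fin p → ℝ`, closeness is closeness of every entry, and a finite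
  -- union bound suffices.
  have hF' : ContinuousAt (fun M : Fin p → Fin p → ℝ => F (Matrix.of M)) fun a b => S a b :=
    ContinuousAt.comp (g := F) (f := fun M : Fin p → Fin p → ℝ => Matrix.of M) hF hof.continuousAt
  obtain ⟨δ, hδ, hball⟩ := Metric.continuousAt_iff.1 hF' ε hε
  have hsum : Tendsto (fun m => ∑ a, ∑ b, P {ω | δ ≤ ‖A m ω a b - S a b‖}) atTop (𝓝 0) := by
    have := tendsto_finsetSum Finset.univ fun a _ =>
      tendsto_finsetSum Finset.univ fun b _ => hA a b δ hδ
    simpa using this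
  refine tendsto_of_tendsto_of_tendsto_of_le_of_le tendsto_const_nhds hsum (fun _ => zero_le)
    fun m => ?_
  calc P {ω | ε ≤ ‖F (A m ω) - F S‖}
      ≤ P (⋃ a, ⋃ b, {ω | δ ≤ ‖A m ω a b - S a b‖}) := by
        refine measure_mono fun ω hω => ?_
        by_contra hcon
        simp only [Set.mem_iUnion, Set.mem_ofPred_eq, not_exists, not_le] at hcon
        have : dist (fun a b => A m ω a b) (fun a b => S a b) < δ := by
          refine (dist_pi_lt_iff hδ).2 fun a => (dist_pi_lt_iff hδ).2 fun b => ?_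
          rw [dist_eq_norm]
          exact hcon a b
        have h2 := hball this
        rw [dist_eq_norm] at h2
        exact absurd h2 (not_lt.2 hω)
    _ ≤ _ := (measure_iUnion_fintype_le _ _).trans
        (Finset.sum_le_sum fun a _ => measure_iUnion_fintype_le _ _)

/-- The inverse is the adjugate divided by the determinant, hence continuous where the determinant
is nonzero. -/
theorem continuousAt_entrySum_inv_sub {p : ℕ} {S : Matrix (Fin p) (Fin p) ℝ} (hS : S.det ≠ 0)
    (B : Matrix (Fin p) (Fin p) ℝ) :
    ContinuousAt (fun A : Matrix (Fin p) (Fin p) ℝ => entrySum (A⁻¹ - B)) S := by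
  have hinv : ContinuousAt (fun A : Matrix (Fin p) (Fin p) ℝ => A⁻¹) S := by
    simp only [Matrix.inv_def, Ring.inverse_eq_inv']
    exact ((continuous_id.matrix_det).continuousAt.inv₀ hS).smul
      (continuous_id.matrix_adjugate).continuousAt
  have hc : Continuous fun A : Matrix (Fin p) (Fin p) ℝ => entrySum (A - B) := by
    unfold entrySum
    fun_prop
  exact hc.continuousAt.comp (f := fun A : Matrix (Fin p) (Fin p) ℝ => A⁻¹) hinv

theorem measurable_inv_apply {p : ℕ} {A : Ω → Matrix (Fin p) (Fin p) ℝ}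
    (hA : ∀ a b, Measurable fun ω => A ω a b) (a b : Fin p) :
    Measurable fun ω => (A ω)⁻¹ a b := by
  have h1 : Measurable fun ω => (fun a b => A ω a b : Fin p → Fin p → ℝ) :=
    measurable_pi_lambda _ fun a => measurable_pi_lambda _ fun b => hA a b
  have hdet : Continuous fun M : Fin p → Fin p → ℝ => Matrix.det (Matrix.of M) :=
    Continuous.matrix_det (continuous_id (X := Matrix (Fin p) (Fin p) ℝ))
  have hadj : Continuous fun M : Fin p → Fin p → ℝ => (Matrix.adjugate (Matrix.of M)) a b :=
    (Continuous.matrix_adjugate (continuous_id (X := Matrix (Fin p) (Fin p) ℝ))).matrix_elem a b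
  have h2 : (fun ω => (A ω)⁻¹ a b) = fun ω => (A ω).det⁻¹ * (A ω).adjugate a b := by
    ext ω
    rw [Matrix.inv_def, Ring.inverse_eq_inv', Matrix.smul_apply, smul_eq_mul]
  rw [h2]
  exact (hdet.measurable.comp h1).inv.mul (hadj.measurable.comp h1)

theorem measurable_quadForm_inv {p : ℕ} {A : Ω → Matrix (Fin p) (Fin p) ℝ}
    (hA : ∀ a b, Measurable fun ω => A ω a b) {v : Ω → EuclideanSpace ℝ (Fin p)}
    (hv : Measurable v) : Measurable fun ω => quadForm (A ω)⁻¹ (v ω) := by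
  have hva : ∀ a, Measurable fun ω => (v ω).ofLp a := fun a => by fun_prop
  simp only [quadForm, dotProduct, Matrix.mulVec]
  refine Finset.measurable_fun_sum _ fun a _ => (hva a).mul ?_
  exact Finset.measurable_fun_sum _ fun b _ => (measurable_inv_apply hA a b).mul (hva b)

end

/-! ### Continuity of the limit functional -/

section

variable {p : ℕ} {B : Matrix (Fin p) (Fin p) ℝ} {w : ℝ → ℝ} {T : ℝ}

/-- The limit functional on `ℓ^∞([0,T+1], ℝ^p)`. -/
def supFunctionalLInfty (B : Matrix (Fin p) (Fin p) ℝ) (w : ℝ → ℝ) (hT : 0 ≤ T + 1)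
    (f : LInfty T p) : ℝ :=
  supFunctional B w T (Set.IccExtend hT f)

/-- Apply the local Lipschitz bound in both directions; the radius `‖g‖ + ‖f - g‖` dominates both
paths. -/
theorem continuous_supFunctionalLInfty (hT : 0 ≤ T) (hT' : 0 ≤ T + 1)
    (hw_mono : MonotoneOn w (Set.Icc 0 T)) (hw_pos : ∀ x ∈ Set.Icc 0 T, 0 < w x) :
    Continuous (supFunctionalLInfty (p := p) B w hT') := by
  have hnorm : ∀ (f : LInfty T p) (s : ℝ), ‖Set.IccExtend hT' f s‖ ≤ ‖f‖ := fun f s =>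
    lp.norm_apply_le_norm (by simp) f _
  have hsub : ∀ (f g : LInfty T p) (s : ℝ),
      ‖Set.IccExtend hT' f s - Set.IccExtend hT' g s‖ ≤ ‖f - g‖ := fun f g s =>
    lp.norm_apply_le_norm (by simp) (f - g) _
  refine continuous_iff_continuousAt.2 fun g => ?_
  have key : ∀ f : LInfty T p, dist (supFunctionalLInfty B w hT' f)
      (supFunctionalLInfty B w hT' g) ≤ entrySum B *
        (2 * (2 * (T + 1) * (‖g‖ + ‖f - g‖)) * (2 * (T + 1) * ‖f - g‖) +
          (2 * (T + 1) * ‖f - g‖) ^ 2) / w 0 := by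
    intro f
    have hf : ‖f‖ ≤ ‖g‖ + ‖f - g‖ := by
      calc ‖f‖ = ‖g + (f - g)‖ := by congr 1; abel
        _ ≤ _ := norm_add_le _ _
    rw [Real.dist_eq, abs_sub_le_iff, sub_le_iff_le_add', sub_le_iff_le_add']
    constructor
    · exact supFunctional_le_add hT hw_mono hw_pos
        (fun s _ => (hnorm g s).trans (by linarith [norm_nonneg (f - g)]))
        fun s _ => hsub f g s
    · exact supFunctional_le_add hT hw_mono hw_pos
        (fun s _ => (hnorm f s).trans hf) fun s _ => by rw [norm_sub_rev]; exact hsub f g s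
  refine tendsto_iff_dist_tendsto_zero.2 (squeeze_zero (fun _ => dist_nonneg) key ?_)
  have hc : Continuous fun f : LInfty T p => entrySum B *
        (2 * (2 * (T + 1) * (‖g‖ + ‖f - g‖)) * (2 * (T + 1) * ‖f - g‖) +
          (2 * (T + 1) * ‖f - g‖) ^ 2) / w 0 := by
    fun_prop
  have := hc.tendsto g
  simpa using this

theorem supFunctional_congr_of_eqOn {h g : ℝ → EuclideanSpace ℝ (Fin p)}
    (hgh : Set.EqOn h g (Set.Icc 1 (T + 1))) : supFunctional B w T h = supFunctional B w T g :=
  supFunctional_congr fun s t hs hst ht => by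
    simp only [pathForm]
    rw [hgh ⟨hs, hst.trans ht⟩, hgh ⟨hs.trans hst, ht⟩]

theorem supFunctionalLInfty_toLInfty (hT' : 0 ≤ T + 1) {h : ℝ → EuclideanSpace ℝ (Fin p)}
    {f : Set.Icc (0 : ℝ) (T + 1) → EuclideanSpace ℝ (Fin p)} (hf : Memℓp f ∞)
    (hfh : ∀ s, f s = h s) : supFunctionalLInfty B w hT' (toLInfty f) = supFunctional B w T h := by
  refine supFunctional_congr_of_eqOn fun s hs => ?_
  have hs0 : s ∈ Set.Icc 0 (T + 1) := ⟨zero_le_one.trans hs.1, hs.2⟩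
  rw [Set.IccExtend_of_mem _ _ hs0, toLInfty, dif_pos hf]
  exact hfh ⟨s, hs0⟩

end

/-! ### The monitoring statistic -/

section

variable {Ω : Type*} {d p : ℕ} {θ : ((Fin d → ℝ) → ℝ) → EuclideanSpace ℝ (Fin p)}
  {X : ℤ → Ω → (Fin d → ℝ)} {SigmaHat : ℕ → Ω → Matrix (Fin p) (Fin p) ℝ} {T : ℝ} {w : ℝ → ℝ}

/-- The scaled difference `m^{-3/2} (m+j) (k-j) (θ̂_1^{m+j} - θ̂_{m+j+1}^{m+k})`. -/
def scaledDiff (θ : ((Fin d → ℝ) → ℝ) → EuclideanSpace ℝ (Fin p)) (X : ℤ → Ω → (Fin d → ℝ))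
    (m : ℕ) (ω : Ω) (j k : ℕ) : EuclideanSpace ℝ (Fin p) :=
  (((m : ℝ) * √(m : ℝ))⁻¹ * (((m : ℝ) + j) * ((k : ℝ) - j))) •
    (thetaHat θ X 1 (m + j) ω - thetaHat θ X (m + j + 1) (m + k) ω)

theorem detector_eq_iSup_quadForm (m k : ℕ) (ω : Ω) :
    detector θ X SigmaHat m k ω =
      ⨆ j : Fin k, quadForm (SigmaHat m ω)⁻¹ (scaledDiff θ X m ω j k) := by
  rw [detector, Real.mul_iSup_of_nonneg (by positivity)]
  refine iSup_congr fun j => ?_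
  rw [scaledDiff, quadForm_smul, mul_pow, inv_pow, mul_pow, Real.sq_sqrt (Nat.cast_nonneg m),
    ← pow_succ, mul_pow]
  exact (mul_assoc _ _ _).symm

theorem div_mem_Icc_of_mem_Icc_floor {m k : ℕ} (hT : 0 ≤ T) (hk : k ∈ Finset.Icc 1 ⌊T * m⌋₊) :
    0 < m ∧ (k : ℝ) / m ∈ Set.Icc 0 T := by
  obtain ⟨h1, h2⟩ := Finset.mem_Icc.1 hk
  have hm : 0 < m := by
    rcases Nat.eq_zero_or_pos m with rfl | h
    · simp at h2; omega
    · exact h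
  refine ⟨hm, by positivity, ?_⟩
  rw [div_le_iff₀ (by exact_mod_cast hm)]
  exact (Nat.cast_le.2 h2).trans (Nat.floor_le (by positivity))

/-- The monitoring scheme rejects if and only if the monitoring statistic exceeds one. -/
theorem stoppingRule_lt_top_iff (hT : 0 ≤ T) (hw_pos : ∀ x ∈ Set.Icc 0 T, 0 < w x) (m : ℕ)
    (ω : Ω) : stoppingRule θ X SigmaHat T w m ω < ⊤ ↔ 1 < monitoringStat θ X SigmaHat T w m ω := by
  have h1 : stoppingRule θ X SigmaHat T w m ω < ⊤ ↔
      ∃ k ∈ Finset.Icc 1 ⌊T * m⌋₊, w ((k : ℝ) / m) < detector θ X SigmaHat m k ω := by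
    rw [stoppingRule, sInf_lt_iff]
    simp [and_assoc]
  rw [h1, monitoringStat]
  rcases isEmpty_or_nonempty (Finset.Icc 1 ⌊T * m⌋₊) with he | hne
  -- If `T * m < 1` nothing is monitored; the empty supremum is `0`, which does not exceed `1`.
  · rw [Real.iSup_of_isEmpty]
    refine iff_of_false ?_ (by norm_num)
    rintro ⟨k, hk, -⟩
    exact he.false ⟨k, hk⟩
  · rw [lt_ciSup_iff (Set.finite_range _).bddAbove]
    constructor
    · rintro ⟨k, hk, h⟩
      exact ⟨⟨k, hk⟩, (one_lt_div (hw_pos _ (div_mem_Icc_of_mem_Icc_floor hT hk).2)).2 h⟩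
    · rintro ⟨⟨k, hk⟩, h⟩
      exact ⟨k, hk, (one_lt_div (hw_pos _ (div_mem_Icc_of_mem_Icc_floor hT hk).2)).1 h⟩

theorem sum_Icc_one_sub_sum_Icc_one {M : Type*} [AddCommGroup M] (f : ℕ → M) {a b : ℕ}
    (hab : a ≤ b) :
    ∑ t ∈ Finset.Icc 1 b, f t - ∑ t ∈ Finset.Icc 1 a, f t = ∑ t ∈ Finset.Icc (a + 1) b, f t := by
  have h : Finset.Icc 1 b = Finset.Icc 1 a ∪ Finset.Icc (a + 1) b := by
    ext x
    simp only [Finset.mem_Icc, Finset.mem_union]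
    omega
  rw [h, Finset.sum_union, add_sub_cancel_left]
  refine Finset.disjoint_left.2 fun x => ?_
  simp only [Finset.mem_Icc]
  omega

/-- The partial sum process as a function on the real line. -/
def partialSumPath (Y : ℤ → Ω → EuclideanSpace ℝ (Fin p)) (m : ℕ) (ω : Ω) (s : ℝ) :
    EuclideanSpace ℝ (Fin p) :=
  (√(m : ℝ))⁻¹ • ∑ t ∈ Finset.Icc 1 ⌊(m : ℝ) * s⌋₊, Y t ω

theorem partialSumPath_floor_div {Y : ℤ → Ω → EuclideanSpace ℝ (Fin p)} {m : ℕ} (hm : 0 < m)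
    (ω : Ω) (s : ℝ) :
    partialSumPath Y m ω (⌊(m : ℝ) * s⌋₊ / m) = partialSumPath Y m ω s := by
  have : (m : ℝ) ≠ 0 := by positivity
  rw [partialSumPath, mul_div_cancel₀ _ this, Nat.floor_natCast, partialSumPath]

theorem partialSumPath_grid {Y : ℤ → Ω → EuclideanSpace ℝ (Fin p)} {m : ℕ} (hm : 0 < m)
    (ω : Ω) (j : ℕ) :
    partialSumPath Y m ω (((m : ℝ) + j) / m) =
      (√(m : ℝ))⁻¹ • ∑ t ∈ Finset.Icc 1 (m + j), Y t ω := by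
  have : (m : ℝ) ≠ 0 := by positivity
  rw [partialSumPath, mul_div_cancel₀ _ this, ← Nat.cast_add, Nat.floor_natCast]

variable [MeasurableSpace Ω] {P : Measure Ω} {IF : (Fin d → ℝ) → EuclideanSpace ℝ (Fin p)}

/-- The maximal weighted remainder `sup_{1 ≤ i ≤ j ≤ n} (j-i+1) |R_{i,j}|`. -/
def maxRemainder (P : Measure Ω) (X : ℤ → Ω → (Fin d → ℝ))
    (θ : ((Fin d → ℝ) → ℝ) → EuclideanSpace ℝ (Fin p))
    (IF : (Fin d → ℝ) → EuclideanSpace ℝ (Fin p)) (n : ℕ) (ω : Ω) : ℝ :=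
  ⨆ ij : {ij : ℕ × ℕ // 1 ≤ ij.1 ∧ ij.1 ≤ ij.2 ∧ ij.2 ≤ n},
    ((ij.1.2 : ℝ) - ij.1.1 + 1) * ‖remainder P X θ IF ij.1.1 ij.1.2 ω‖

theorem le_maxRemainder {i j n : ℕ} (hi : 1 ≤ i) (hij : i ≤ j) (hjn : j ≤ n) (ω : Ω) :
    ((j : ℝ) - i + 1) * ‖remainder P X θ IF i j ω‖ ≤ maxRemainder P X θ IF n ω := by
  have : Finite {ij : ℕ × ℕ // 1 ≤ ij.1 ∧ ij.1 ≤ ij.2 ∧ ij.2 ≤ n} :=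
    ((Set.finite_Iic n).prod (Set.finite_Iic n)).subset
      fun ij h => ⟨h.2.1.trans h.2.2, h.2.2⟩
  exact le_ciSup (f := fun ij : {ij : ℕ × ℕ // 1 ≤ ij.1 ∧ ij.1 ≤ ij.2 ∧ ij.2 ≤ n} =>
    ((ij.1.2 : ℝ) - ij.1.1 + 1) * ‖remainder P X θ IF ij.1.1 ij.1.2 ω‖)
    (Set.finite_range _).bddAbove ⟨(i, j), hi, hij, hjn⟩

/-- The value `θ(F)` cancels in the difference of the two estimators, and the two averages of
influence values combine exactly into `pathForm` at the grid times. -/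
theorem scaledDiff_sub_pathForm {m j k : ℕ} (hm : 0 < m) (hjk : j < k) (ω : Ω) :
    scaledDiff θ X m ω j k - pathForm (partialSumPath (fun t ω => IF (X t ω)) m ω)
        (((m : ℝ) + j) / m) (((m : ℝ) + k) / m) =
      (((m : ℝ) * √(m : ℝ))⁻¹ * (((m : ℝ) + j) * ((k : ℝ) - j))) •
        (remainder P X θ IF 1 (m + j) ω - remainder P X θ IF (m + j + 1) (m + k) ω) := by
  have hm' : (0 : ℝ) < m := by exact_mod_cast hm
  have hjk' : (0 : ℝ) < (k : ℝ) - j := by rw [sub_pos]; exact_mod_cast hjk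
  have hsq : √(m : ℝ) ≠ 0 := (Real.sqrt_pos.2 hm').ne'
  have ha : ((m : ℝ) + j) ≠ 0 := by positivity
  have hS := sum_Icc_one_sub_sum_Icc_one (fun t : ℕ => IF (X t ω))
    (show m + j ≤ m + k by omega)
  rw [pathForm, partialSumPath_grid hm, partialSumPath_grid hm, scaledDiff, remainder, remainder,
    ← hS]
  set Sa := ∑ t ∈ Finset.Icc 1 (m + j), IF (X t ω)
  set Sb := ∑ t ∈ Finset.Icc 1 (m + k), IF (X t ω)
  have e1 : (((m + j : ℕ) : ℝ) - (1 : ℕ) + 1)⁻¹ = ((m : ℝ) + j)⁻¹ := by push_cast; ring_nf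
  have e2 : (((m + k : ℕ) : ℝ) - (m + j + 1 : ℕ) + 1)⁻¹ = ((k : ℝ) - j)⁻¹ := by
    push_cast; ring_nf
  rw [e1, e2]
  have key : (((m : ℝ) + k) / m) • (√(m : ℝ))⁻¹ • Sa - (((m : ℝ) + j) / m) • (√(m : ℝ))⁻¹ • Sb =
      (((m : ℝ) * √(m : ℝ))⁻¹ * (((m : ℝ) + j) * ((k : ℝ) - j))) •
        (((m : ℝ) + j)⁻¹ • Sa - ((k : ℝ) - j)⁻¹ • (Sb - Sa)) := by
    ext b
    simp only [PiLp.sub_apply, PiLp.smul_apply, smul_eq_mul]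
    field_simp
    ring
  rw [key, ← smul_sub]
  congr 1
  abel

/-- The first remainder comes with its own weight `m + j` and an extra factor `k - j ≤ T * m`; the
second with its weight `k - j` and an extra factor `m + j ≤ (T + 1) * m`. Together they give `2 * T
+ 1`, and `√(T + 1)` converts `√m` into the square root of the sample size `m + ⌊T * m⌋₊`. -/
theorem norm_scaledDiff_sub_pathForm_le (hT : 0 ≤ T) {m j k : ℕ} (hm : 0 < m) (hjk : j < k)
    (hk : k ≤ ⌊T * m⌋₊) (ω : Ω) :
    ‖scaledDiff θ X m ω j k - pathForm (partialSumPath (fun t ω => IF (X t ω)) m ω)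
        (((m : ℝ) + j) / m) (((m : ℝ) + k) / m)‖ ≤
      (2 * T + 1) * √(T + 1) * (maxRemainder P X θ IF (m + ⌊T * m⌋₊) ω /
        √((m + ⌊T * m⌋₊ : ℕ) : ℝ)) := by
  have hm' : (0 : ℝ) < m := by exact_mod_cast hm
  have hjk' : (j : ℝ) < k := by exact_mod_cast hjk
  have hfl : (⌊T * m⌋₊ : ℝ) ≤ T * m := Nat.floor_le (by positivity)
  have hkT : (k : ℝ) ≤ T * m := (Nat.cast_le.2 hk).trans hfl
  have hj0 : (0 : ℝ) ≤ j := Nat.cast_nonneg j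
  have hsq := Real.sqrt_pos.2 hm'
  set n := m + ⌊T * m⌋₊ with hn
  set A := maxRemainder P X θ IF n ω
  have hR1 := le_maxRemainder (P := P) (X := X) (θ := θ) (IF := IF) (i := 1) (j := m + j) (n := n)
    le_rfl (by omega) (by omega) ω
  have hR2 := le_maxRemainder (P := P) (X := X) (θ := θ) (IF := IF) (i := m + j + 1) (j := m + k)
    (n := n) (by omega) (by omega) (by omega) ω
  rw [scaledDiff_sub_pathForm (P := P) hm hjk, norm_smul, Real.norm_of_nonneg (by
    have := sub_pos.2 hjk'
    positivity)]
  set R1 := remainder P X θ IF 1 (m + j) ω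
  set R2 := remainder P X θ IF (m + j + 1) (m + k) ω
  have e1 : ((m + j : ℕ) : ℝ) - (1 : ℕ) + 1 = (m : ℝ) + j := by push_cast; ring
  have e2 : ((m + k : ℕ) : ℝ) - (m + j + 1 : ℕ) + 1 = (k : ℝ) - j := by push_cast; ring
  rw [e1] at hR1
  rw [e2] at hR2
  have hA : 0 ≤ A := le_trans (by positivity) hR1
  have h1 : ((k : ℝ) - j) * (((m : ℝ) + j) * ‖R1‖) ≤ (T * m) * A :=
    mul_le_mul (by linarith) hR1 (by positivity) (by positivity)
  have h2 : ((m : ℝ) + j) * (((k : ℝ) - j) * ‖R2‖) ≤ ((T + 1) * m) * A :=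
    mul_le_mul (by linarith) hR2 (mul_nonneg (by linarith) (norm_nonneg _)) (by positivity)
  have hnm : √(n : ℝ) ≤ √(T + 1) * √(m : ℝ) := by
    rw [← Real.sqrt_mul (by linarith)]
    refine Real.sqrt_le_sqrt ?_
    rw [hn]
    push_cast
    linarith
  have hn0 : 0 < √(n : ℝ) := Real.sqrt_pos.2 (by
    rw [hn]; push_cast; positivity)
  calc ((m : ℝ) * √(m : ℝ))⁻¹ * (((m : ℝ) + j) * ((k : ℝ) - j)) * ‖R1 - R2‖
      ≤ ((m : ℝ) * √(m : ℝ))⁻¹ * (((m : ℝ) + j) * ((k : ℝ) - j)) * (‖R1‖ + ‖R2‖) := by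
        have := sub_pos.2 hjk'
        gcongr
        exact norm_sub_le _ _
    _ = ((m : ℝ) * √(m : ℝ))⁻¹ * (((k : ℝ) - j) * (((m : ℝ) + j) * ‖R1‖) +
          ((m : ℝ) + j) * (((k : ℝ) - j) * ‖R2‖)) := by ring
    _ ≤ ((m : ℝ) * √(m : ℝ))⁻¹ * ((T * m) * A + ((T + 1) * m) * A) := by gcongr
    _ = (2 * T + 1) * A * (√(m : ℝ))⁻¹ := by field_simp; ring
    _ ≤ (2 * T + 1) * A * (√(T + 1) * (√(n : ℝ))⁻¹) := by
        gcongr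
        rw [← div_eq_mul_inv, le_div_iff₀ hn0, inv_mul_le_iff₀ hsq]
        linarith
    _ = _ := by ring

theorem measurable_monitoringStat (hT : 0 ≤ T)
    (hθ : ∀ i j, 1 ≤ i → i ≤ j → Measurable (thetaHat θ X i j))
    (hSigmaHat : ∀ m a b, Measurable fun ω => SigmaHat m ω a b) (m : ℕ) :
    Measurable (monitoringStat θ X SigmaHat T w m) := by
  refine Measurable.iSup fun k => ?_
  obtain ⟨k, hk⟩ := k
  have hm := (div_mem_Icc_of_mem_Icc_floor hT hk).1
  refine Measurable.div_const ?_ _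
  have h : detector θ X SigmaHat m k = fun ω =>
      ⨆ j : Fin k, quadForm (SigmaHat m ω)⁻¹ (scaledDiff θ X m ω j k) :=
    funext fun ω => detector_eq_iSup_quadForm m k ω
  rw [h]
  refine Measurable.iSup fun j => ?_
  have hv : Measurable fun ω => scaledDiff θ X m ω j k := by
    have h1 := hθ 1 (m + j) le_rfl (by omega)
    have h2 := hθ (m + j + 1) (m + k) (by omega) (by have := j.2; omega)
    unfold scaledDiff
    fun_prop
  exact measurable_quadForm_inv (hSigmaHat m) hv

end

/-! ### Asymptotic equivalence with the functional of the partial sums -/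

section

variable {Ω Ω' : Type*} [MeasurableSpace Ω] [MeasurableSpace Ω'] {P : Measure Ω}
  [IsProbabilityMeasure P] {P' : Measure Ω'} [IsProbabilityMeasure P'] {d p : ℕ} {T : ℝ}
  {X : ℤ → Ω → (Fin d → ℝ)} {θ : ((Fin d → ℝ) → ℝ) → EuclideanSpace ℝ (Fin p)}
  {IF : (Fin d → ℝ) → EuclideanSpace ℝ (Fin p)} {W : ℝ≥0 → Ω' → EuclideanSpace ℝ (Fin p)}
  {SigmaF : Matrix (Fin p) (Fin p) ℝ} {SigmaHat : ℕ → Ω → Matrix (Fin p) (Fin p) ℝ} {w : ℝ → ℝ}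

theorem supFunctionalLInfty_scaledBrownian (hT : 0 ≤ T + 1) (hS : SigmaF.PosSemidef)
    (hdet : SigmaF.det ≠ 0) {ω : Ω'} (hc : Continuous fun t => W t ω) :
    supFunctionalLInfty SigmaF⁻¹ w hT (toLInfty (scaledBrownian T SigmaF W ω)) =
      limitStat W T w ω := by
  rw [supFunctionalLInfty_toLInfty hT (memlp_scaledBrownian T SigmaF W ω hc)
    (h := fun s => WithLp.toLp 2 (CFC.sqrt SigmaF *ᵥ (W s.toNNReal ω).ofLp)) fun s => rfl,
    limitStat_eq_supFunctional]
  refine supFunctional_congr fun s t _ _ _ => ?_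
  have : pathForm (fun s => WithLp.toLp 2 (CFC.sqrt SigmaF *ᵥ (W s.toNNReal ω).ofLp)) s t =
      WithLp.toLp 2 (CFC.sqrt SigmaF *ᵥ (pathForm (fun s => W s.toNNReal ω) s t).ofLp) := by
    simp only [pathForm, WithLp.ofLp_sub, WithLp.ofLp_smul, Matrix.mulVec_sub, Matrix.mulVec_smul,
      WithLp.toLp_sub, WithLp.toLp_smul]
  rw [this, quadForm_inv_sqrt_mulVec hS hdet, quadForm_one]

/-- The grid comparison is a deterministic bound in three quantities: the sup norm of the partial
sum process, tight by weak convergence; the entrywise error of the inverse matrix; and the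
normalized maximal remainder. The last two tend to zero in probability. -/
theorem tendstoInMeasure_monitoringStat_sub (hT : 0 < T) (hS : SigmaF.PosSemidef)
    (hSigmaF : SigmaF.det ≠ 0) (hA1 : InvarianceAssumption P X θ IF SigmaF T P' W)
    (hA2 : RemainderAssumption P X θ IF)
    (hcons : ∀ a b, TendstoInMeasure P (fun m ω => SigmaHat m ω a b) atTop
      (fun _ => SigmaF a b))
    (hw_mono : MonotoneOn w (Set.Icc 0 T)) (hw_pos : ∀ x ∈ Set.Icc 0 T, 0 < w x)
    (hT' : 0 ≤ T + 1) :
    TendstoInMeasure P (fun m ω => monitoringStat θ X SigmaHat T w m ω -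
      supFunctionalLInfty SigmaF⁻¹ w hT'
        (toLInfty (partialSumProcess T (fun t ω => IF (X t ω)) m ω))) atTop fun _ => 0 := by
  set B := SigmaF⁻¹
  set Z : ℕ → Ω → LInfty T p :=
    fun m ω => toLInfty (partialSumProcess T (fun t ω => IF (X t ω)) m ω) with hZ
  have hx : TendstoInMeasure P (fun m ω => entrySum ((SigmaHat m ω)⁻¹ - B)) atTop fun _ => 0 := by
    have := tendstoInMeasure_comp_matrix hcons (continuousAt_entrySum_inv_sub hSigmaF B)
    simpa [B, entrySum] using this
  have hy : TendstoInMeasure P (fun (m : ℕ) ω => maxRemainder P X θ IF (m + ⌊T * m⌋₊) ω /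
      √((m + ⌊T * m⌋₊ : ℕ) : ℝ)) atTop fun _ => 0 :=
    TendstoInMeasure.comp hA2 (tendsto_atTop_mono (fun m => Nat.le_add_right m _) tendsto_id)
  have hnorm : TendstoInDistribution (fun m ω => ‖Z m ω‖) atTop _ (fun _ => P) P' :=
    hA1.weakConvergence.continuous_comp continuous_norm
  refine tendstoInMeasure_zero_of_tight
    (fun ε hε => exists_eventually_measure_setOf_le_lt hnorm hε) hx hy fun K ε hε => ?_
  set N := max K 0 with hN
  have hN0 : 0 ≤ N := le_max_right _ _
  set C := (2 * T + 1) * √(T + 1) with hC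
  have hC0 : 0 ≤ C := by positivity
  have hw0 := hw_pos 0 ⟨le_rfl, hT.le⟩
  -- The bound of `abs_gridMax_sub_supFunctional_le` with the matrix error, `ρ` and `1 / m` all
  -- replaced by one number `e`; it vanishes at `e = 0`.
  have hBd : Continuous fun e : ℝ => (e * (2 * (T + 1) * N + e) ^ 2 +
        entrySum B * (2 * (2 * (T + 1) * N) * e + e ^ 2)) / w 0 +
      entrySum B * (2 * (2 * (T + 1) * N) * (2 * N * e) + (2 * N * e) ^ 2) / w 0 := by
    fun_prop
  have hlim := (hBd.tendsto 0).eventually_lt_const (u := ε) (by simpa using hε)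
  obtain ⟨r, hr, hball⟩ := Metric.eventually_nhds_iff.1 hlim
  set e := r / 2 with he
  have he0 : 0 < e := by positivity
  have hBe := hball (y := e) (by
    rw [Real.dist_eq, sub_zero, abs_of_pos he0]; linarith)
  -- Dividing by `C + 1` keeps the matrix error below `e` and the remainder, after multiplication by
  -- `C`, at most `e`.
  refine ⟨e / (C + 1), by positivity, ?_⟩
  -- The thresholds give a nonempty grid, `1 ≤ T * m`, and a mesh `1 / m ≤ e`.
  filter_upwards [eventually_ge_atTop ⌈T⁻¹⌉₊, eventually_ge_atTop ⌈e⁻¹⌉₊,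
    eventually_gt_atTop 0] with m h1 h2 hm ω hK hxω hyω
  have hm' : (0 : ℝ) < m := by exact_mod_cast hm
  have hTm : 1 ≤ T * m := by
    have := (Nat.le_ceil _).trans (Nat.cast_le.2 h1)
    rwa [inv_le_iff_one_le_mul₀' hT] at this
  have hem : 1 / (m : ℝ) ≤ e := by
    have := (Nat.le_ceil _).trans (Nat.cast_le.2 h2)
    rw [inv_le_iff_one_le_mul₀' he0] at this
    rwa [div_le_iff₀ hm']
  have heC : e / (C + 1) ≤ e := div_le_self he0.le (by linarith)
  have hmem := memlp_partialSumProcess T (fun t ω => IF (X t ω)) m ω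
  have hpath : ∀ s ∈ Set.Icc (1 : ℝ) (T + 1),
      ‖partialSumPath (fun t ω => IF (X t ω)) m ω s‖ ≤ N := by
    intro s hs
    have hs0 : s ∈ Set.Icc (0 : ℝ) (T + 1) := ⟨zero_le_one.trans hs.1, hs.2⟩
    have h3 := lp.norm_apply_le_norm (by simp) (Z m ω) ⟨s, hs0⟩
    simp only [hZ, toLInfty, dif_pos hmem] at h3 hK
    exact h3.trans (hK.le.trans (le_max_left _ _))
  have hgrid := abs_gridMax_sub_supFunctional_le (A := (SigmaHat m ω)⁻¹) (B := B) (ρ := e)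
    (h := partialSumPath (fun t ω => IF (X t ω)) m ω) (u := scaledDiff θ X m ω) hT.le hw_mono
    hw_pos (fun v => by
      have h := (Matrix.posSemidef_iff_dotProduct_mulVec.1 hS.inv).2 v.ofLp
      rwa [star_trivial] at h) hTm hpath
    (fun s _ => partialSumPath_floor_div hm ω s) (fun j k hjk hk => by
      refine (norm_scaledDiff_sub_pathForm_le (P := P) hT.le hm hjk hk ω).trans ?_
      calc C * _ ≤ C * (e / (C + 1)) :=
            mul_le_mul_of_nonneg_left ((le_abs_self _).trans hyω.le) hC0
        _ = e * (C / (C + 1)) := by ring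
        _ ≤ e * 1 := by
            gcongr
            exact (div_le_one (by positivity)).2 (by linarith)
        _ = e := mul_one e)
  rw [supFunctionalLInfty_toLInfty hT' hmem
    (h := partialSumPath (fun t ω => IF (X t ω)) m ω) fun s => rfl]
  simp only [monitoringStat, detector_eq_iSup_quadForm]
  refine (hgrid.trans ?_).trans_lt hBe
  have hxe := (le_abs_self _).trans (hxω.le.trans heC)
  have hB0 := entrySum_nonneg B
  have hNm : 2 * N / m ≤ 2 * N * e := by
    rw [div_eq_mul_one_div]
    gcongr
  gcongr

end

end

end SeqMonitoring

theorem mainTheorem2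
    {Ω Ω' : Type*} [MeasurableSpace Ω] [MeasurableSpace Ω']
    (P : Measure Ω) [IsProbabilityMeasure P] (P' : Measure Ω') [IsProbabilityMeasure P']
    {d p : ℕ} (T : ℝ) (hT : 0 < T)
    (X : ℤ → Ω → (Fin d → ℝ)) (hX : ∀ t, Measurable (X t))
    (θ : ((Fin d → ℝ) → ℝ) → EuclideanSpace ℝ (Fin p))
    (hθ : ∀ i j, 1 ≤ i → i ≤ j → Measurable (thetaHat θ X i j))
    (IF : (Fin d → ℝ) → EuclideanSpace ℝ (Fin p)) (hIF : Measurable IF)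
    (W : ℝ≥0 → Ω' → EuclideanSpace ℝ (Fin p)) (hW : IsStandardBrownianMotion W P')
    (SigmaF : Matrix (Fin p) (Fin p) ℝ) (hSigmaF : SigmaF.det ≠ 0)
    (hH0 : NullHypothesis θ P X)
    (hA1 : InvarianceAssumption P X θ IF SigmaF T P' W)
    (hA2 : RemainderAssumption P X θ IF)
    (SigmaHat : ℕ → Ω → Matrix (Fin p) (Fin p) ℝ)
    (hSigmaHat_meas : ∀ m a b, Measurable fun ω => SigmaHat m ω a b)
    (hSigmaHat_nonsing : ∀ m, 1 ≤ m → ∀ᵐ ω ∂P, (SigmaHat m ω).det ≠ 0)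
    (hSigmaHat_consistent : ∀ a b, TendstoInMeasure P (fun m ω => SigmaHat m ω a b) atTop
      (fun _ => SigmaF a b))
    (w : ℝ → ℝ) (hw_mono : MonotoneOn w (Set.Icc 0 T)) (hw_pos : ∀ x ∈ Set.Icc 0 T, 0 < w x) :
    TendstoInDistribution (fun (m : ℕ) ω => monitoringStat θ X SigmaHat T w m ω) atTop
      (fun ω' => limitStat W T w ω') (fun _ => P) P' ∧
    ∀ α : ℝ, P'.real {ω' | 1 < limitStat W T w ω'} = α →
      Tendsto (fun m : ℕ => P.real {ω | 1 < monitoringStat θ X SigmaHat T w m ω}) atTop (𝓝 α) ∧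
      Tendsto (fun m : ℕ => P.real {ω | stoppingRule θ X SigmaHat T w m ω < ⊤}) atTop (𝓝 α) := by
  have hT' : 0 ≤ T + 1 := by linarith
  have hS := posSemidef_of_isLongRunVariance hX hA1.stationary hIF hA1.longRun
  have h1 := hA1.weakConvergence.continuous_comp
    (continuous_supFunctionalLInfty (B := SigmaF⁻¹) hT.le hT' hw_mono hw_pos)
  have h2 := h1.congr (fun _ => EventuallyEq.rfl) (hW.ae_continuous.mono fun ω hc =>
    supFunctionalLInfty_scaledBrownian (w := w) hT' hS hSigmaF hc)
  have hmeas := measurable_monitoringStat (w := w) hT.le hθ hSigmaHat_meas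
  have hconv : TendstoInDistribution (fun (m : ℕ) ω => monitoringStat θ X SigmaHat T w m ω) atTop
      (fun ω' => limitStat W T w ω') (fun _ => P) P' :=
    tendstoInDistribution_of_tendstoInMeasure_sub _ _ h2
      (tendstoInMeasure_monitoringStat_sub hT hS hSigmaF hA1 hA2 hSigmaHat_consistent hw_mono
        hw_pos hT') fun m => (hmeas m).aemeasurable
  refine ⟨hconv, ?_⟩
  rintro α rfl
  -- The portmanteau theorem for `(1, ∞)` requires its boundary `{1}` to be null for the limit law.
  have hfr : (P'.map fun ω' => limitStat W T w ω') (frontier (Set.Ioi 1)) = 0 := by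
    rw [frontier_Ioi, Measure.map_apply_of_aemeasurable hconv.aemeasurable_limit
      (measurableSet_singleton _)]
    exact hW.measure_limitStat_eq_one hT.le hw_mono hw_pos
  have hlim := ProbabilityMeasure.tendsto_measure_of_null_frontier_of_tendsto' hconv.tendsto hfr
  simp only [ProbabilityMeasure.coe_mk] at hlim
  rw [Measure.map_apply_of_aemeasurable hconv.aemeasurable_limit measurableSet_Ioi] at hlim
  have hreal := (ENNReal.tendsto_toReal (measure_ne_top _ _)).comp hlim
  have hstat : Tendsto (fun m : ℕ => P.real {ω | 1 < monitoringStat θ X SigmaHat T w m ω}) atTop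
      (𝓝 (P'.real {ω' | 1 < limitStat W T w ω'})) := by
    refine hreal.congr fun m => ?_
    simp only [Function.comp_apply]
    rw [Measure.map_apply (hmeas m) measurableSet_Ioi]
    rfl
  refine ⟨hstat, ?_⟩
  simpa only [stoppingRule_lt_top_iff hT.le hw_pos] using hstat
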